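/- All Hilbert spaces are finite-dimensional and complex; $\mathbb{Z}_2=\{0,1\}$; $\mathsf{Q}=\mathbb{C}^2$ is a qubit with Pauli operators $X,Z$ and Hadamard operator $H$, and $|\beta\rangle=\cos\frac{\pi}{8}|0\rangle+\sin\frac{\pi}{8}|1\rangle$. **The game.** In the TFKW game, Alice picks $\theta\in\mathbb{Z}_2$ uniformly and measures a qubit with the projectors $A^\theta_y=|y^\theta\rangle\langle y^\theta|$, where $|y^\theta\rangle=H^\theta|y\rangle$. In its $n$-fold parallel repetition $\mathtt{TFKW}^n$, the question $\theta\in\mathbb{Z}_2^n$ is uniform and Alice measures $\mathsf{A}=\mathsf{Q}^{\otimes n}$ with $A^{\theta}_{x}=A^{\theta_1}_{x_1}\otimes\cdots\otimes A^{\theta_n}_{x_n}$, $x\in\mathbb{Z}_2^n$. A *purified strategy* $\mathtt{S}$ for $\mathtt{TFKW}^n$ consists of Hilbert spaces $\mathsf{B},\mathsf{C},\mathsf{R}$, projective measurements $(B^\theta_x)_{x\in\mathbb{Z}_2^n}$ on $\mathsf{B}$ and $(C^\theta_x)_{x\in\mathbb{Z}_2^n}$ on $\mathsf{C}$ for each $\theta\in\mathbb{Z}_2^n$,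 and a unit vector $|\psi\rangle\in\mathsf{A}\otimes\mathsf{B}\otimes\mathsf{C}\otimes\mathsf{R}$. For $i\in\{1,\dots,n\}$ and $y\in\mathbb{Z}_2$ let $A^\theta_{y,i}=\sum_{x:\,x_i=y}A^\theta_x$, and similarly $B^\theta_{y,i}$, $C^\theta_{y,i}$. The *$i$-th winning probability* is $$\mathfrak{w}^i(\mathtt{S})=\frac{1}{2^n}\sum_{\theta\in\mathbb{Z}_2^n}\sum_{y\in\mathbb{Z}_2}\langle\psi|A^\theta_{y,i}\otimes B^\theta_{y,i}\otimes C^\theta_{y,i}\otimes 1_{\mathsf{R}}|\psi\rangle .$$ For $\varphi\in\mathbb{Z}_2^n$ with $\varphi_i=0$ and $\theta\in\mathbb{Z}_2$, put ${}^{\varphi,i}B_\theta=B^{\varphi+\theta 1^i}_{0,i}-B^{\varphi+\theta 1^i}_{1,i}$ and ${}^{\varphi,i}C_\theta=C^{\varphi+\theta 1^i}_{0,i}-C^{\varphi+\theta 1^i}_{1,i}$, where $1^i$ is the string with a single $1$, in position $i$. Vectors $|v\rangle,|w\rangle\in\mathsf{B}'\otimes\mathsf{C}'\otimes\mathsf{R}$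 have *orthogonal supports on $\mathsf{B}'$* if the ranges of their reduced operators $\operatorname{Tr}_{\mathsf{C}'\mathsf{R}}|v\rangle\langle v|$ and $\operatorname{Tr}_{\mathsf{C}'\mathsf{R}}|w\rangle\langle w|$ are orthogonal; similarly for $\mathsf{C}'$. Operators on one tensor factor are extended to the others by the identity. **Theorem (robust parallel-repeated rigidity).** There are universal constants $K,L\ge 0$ such that the following holds. Let $n\ge 1$, let $\mathtt{S}$ be a purified strategy for $\mathtt{TFKW}^n$ as above, let $\varepsilon\ge 0$, and suppose that $\mathfrak{w}^i(\mathtt{S})\ge\cos^2\frac{\pi}{8}-\varepsilon$ for every $i\in\{1,\dots,n\}$. Then there exist Hilbert spaces $\mathsf{B}',\mathsf{C}'$, isometries $V:\mathsf{B}\to\mathsf{B}'$ and $W:\mathsf{C}\to\mathsf{C}'$, vectors $|\psi_t\rangle\in\mathsf{B}'\otimes\mathsf{C}'\otimes\mathsf{R}$ for $t=(t_{i\theta})\in(\mathbb{Z}_2^2)^n$, for every $i$ a string $\varphi^i\in\mathbb{Z}_2^n$ with $(\varphi^i)_i=0$, and self-adjoint unitaries ${}^iB'_\theta$ on $\mathsf{B}'$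 and ${}^iC'_\theta$ on $\mathsf{C}'$ ($1\le i\le n$, $\theta\in\mathbb{Z}_2$) such that: 1. the vector $$|\phi\rangle=\sum_{t\in(\mathbb{Z}_2^2)^n}X^{t_{10}}Z^{t_{11}}|\beta\rangle\otimes\cdots\otimes X^{t_{n0}}Z^{t_{n1}}|\beta\rangle\otimes|\psi_t\rangle$$ is a unit vector and $\big\|(V\otimes W)|\psi\rangle-|\phi\rangle\big\|\le Kn^3\sqrt{\varepsilon}$; 2. for $t\ne t'$, the vectors $|\psi_t\rangle$ and $|\psi_{t'}\rangle$ have orthogonal supports on $\mathsf{B}'$ and on $\mathsf{C}'$; 3. all the operators ${}^iB'_\theta$ commute with each other, and all the operators ${}^iC'_\theta$ commute with each other; 4. for all $i$ and $\theta$, $$\big\|V\,{}^{\varphi^i,i}B_\theta|\psi\rangle-{}^iB'_\theta V|\psi\rangle\big\|\le Ln^2\sqrt{\varepsilon},\qquad \big\|W\,{}^{\varphi^i,i}C_\theta|\psi\rangle-{}^iC'_\theta W|\psi\rangle\big\|\le Ln^2\sqrt{\varepsilon};$$ 5. for all $i$, $\theta$ and $t$, $\;{}^iB'_\theta|\psi_t\rangle={}^iC'_\theta|\psi_t\rangle=(-1)^{t_{i\theta}}|\psi_t\rangle$.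 -/

import Mathlib

open scoped Matrix Kronecker ComplexOrder

universe u v w

noncomputable section

/-!
Every finite-dimensional Hilbert space is written as the space `EuclideanSpace ℂ H` spanned by an
orthonormal basis that is indexed by a finite register `H`. The tensor product of the spaces of
the registers `H` and `K` is the space of the register `H × K`, the `n`-fold tensor power of the
space of `H` is the space of the register `Fin n → H`, and linear operators are matrices. The bit
`ℤ₂ = {0, 1}` is `Fin 2`, whose addition is addition modulo 2.
-/

section Operators

/-- The action of an operator (a matrix) on a vector of a Hilbert space. -/
def ap {K H : Type*} [Fintype H] (M : Matrix K H ℂ) (v : EuclideanSpace ℂ H) :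
    EuclideanSpace ℂ K :=
  WithLp.toLp 2 (M *ᵥ v.ofLp)

/-- The rank-one operator `|v⟩⟨v|`. -/
def ketbra {H : Type*} (v : EuclideanSpace ℂ H) : Matrix H H ℂ :=
  Matrix.vecMulVec v.ofLp (star v.ofLp)

/-- The tensor product of two vectors. -/
def tensorVec {H K : Type*} (u : EuclideanSpace ℂ H) (v : EuclideanSpace ℂ K) :
    EuclideanSpace ℂ (H × K) :=
  WithLp.toLp 2 fun p => u p.1 * v p.2

/-- The tensor product `u₁ ⊗ ⋯ ⊗ uₙ` of `n` vectors. -/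
def tensorPiVec {n : ℕ} {H : Type*} (u : Fin n → EuclideanSpace ℂ H) :
    EuclideanSpace ℂ (Fin n → H) :=
  WithLp.toLp 2 fun a => ∏ i, u i (a i)

/-- The tensor product `M₁ ⊗ ⋯ ⊗ Mₙ` of `n` operators. -/
def tensorPiOp {n : ℕ} {H : Type*} (M : Fin n → Matrix H H ℂ) :
    Matrix (Fin n → H) (Fin n → H) ℂ :=
  Matrix.of fun a b => ∏ i, M i (a i) (b i)

/-- An isometry from the space of `H` to the space of `K`. -/
def IsIsometryOp {K H : Type*} [Fintype K] [DecidableEq H] (V : Matrix K H ℂ) : Prop :=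
  Vᴴ * V = 1

/-- A unitary observable: a self-adjoint unitary operator. -/
def IsUnitaryObservable {H : Type*} [Fintype H] [DecidableEq H] (M : Matrix H H ℂ) : Prop :=
  M.IsHermitian ∧ M ∈ Matrix.unitaryGroup H ℂ

theorem posSemidef_tensorPiOp {n : ℕ} {H : Type*} [Fintype H] (M : Fin n → Matrix H H ℂ)
    (hM : ∀ i, (M i).PosSemidef) : (tensorPiOp M).PosSemidef := by
  classical
  have h : ∀ i, ∃ B : Matrix H H ℂ, M i = Bᴴ * B := fun i => by
    open scoped MatrixOrder in
    exact CStarAlgebra.nonneg_iff_eq_star_mul_self.mp (hM i).nonneg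
  choose B hB using h
  have e : tensorPiOp M = (tensorPiOp B)ᴴ * tensorPiOp B := by
    ext a b
    simp only [tensorPiOp, Matrix.of_apply, Matrix.mul_apply, Matrix.conjTranspose_apply, hB,
      star_prod, ← Finset.prod_mul_distrib]
    rw [Fintype.prod_sum]
  rw [e]
  exact Matrix.posSemidef_conjTranspose_mul_self _

theorem sum_tensorPiOp {n : ℕ} {Y H : Type*} [Fintype Y] [DecidableEq H]
    (P : Fin n → Y → Matrix H H ℂ) (hP : ∀ i, ∑ y, P i y = 1) :
    ∑ y : Fin n → Y, tensorPiOp (fun i => P i (y i)) = 1 := by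
  ext a b
  have h : ∀ i c d, ∑ y, P i y c d = (1 : Matrix H H ℂ) c d := fun i c d => by
    rw [← hP i, Matrix.sum_apply]
  simp only [Matrix.sum_apply, tensorPiOp, Matrix.of_apply]
  rw [← Fintype.prod_sum (fun i y => P i y (a i) (b i))]
  simp only [h, Matrix.one_apply, Finset.prod_ite_zero, Finset.prod_const_one, Finset.mem_univ,
    true_implies, funext_iff]

end Operators

section Measurements

/-- A positive operator-valued measurement on the space of `H` with outcomes in `Y`. -/
structure POVM (Y H : Type*) [Fintype Y] [DecidableEq H] where
  /-- The operator of each outcome. -/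
  op : Y → Matrix H H ℂ
  posSemidef : ∀ y, (op y).PosSemidef
  sum_eq_one : ∑ y, op y = 1

/-- A measurement is projective if its operators are mutually orthogonal projectors. -/
def POVM.IsProjective {Y H : Type*} [Fintype Y] [DecidableEq Y] [Fintype H] [DecidableEq H]
    (P : POVM Y H) : Prop :=
  ∀ y y', P.op y * P.op y' = if y = y' then P.op y else 0

/-- The observable `P₀ - P₁` of a two-outcome measurement. -/
def POVM.observable {H : Type*} [DecidableEq H] (P : POVM (Fin 2) H) : Matrix H H ℂ :=
  P.op 0 - P.op 1

/-- The measurement of the `i`-th answer: `P_{y,i} = ∑_{x : x_i = y} P_x`. -/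
def POVM.marginal {n : ℕ} {Y H : Type*} [Fintype Y] [DecidableEq Y] [DecidableEq H]
    (P : POVM (Fin n → Y) H) (i : Fin n) : POVM Y H where
  op y := ∑ x : Fin n → Y with x i = y, P.op x
  posSemidef y := Matrix.posSemidef_sum _ fun x _ => P.posSemidef x
  sum_eq_one := by
    rw [Finset.sum_fiberwise, P.sum_eq_one]

end Measurements

section Games

/-- A monogamy-of-entanglement game with questions `Θ`, answers `Y` and Alice's register `A`. -/
structure MoEGame (Θ Y A : Type*) [Fintype Θ] [Fintype Y] [DecidableEq A] where
  /-- The probability of each question. -/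
  prob : Θ → ℝ
  prob_nonneg : ∀ θ, 0 ≤ prob θ
  prob_sum : ∑ θ, prob θ = 1
  /-- Alice's measurement for each question. -/
  alice : Θ → POVM Y A

/-- The `n`-fold parallel repetition of a game. -/
def MoEGame.parallel {Θ Y A : Type*} [Fintype Θ] [Fintype Y] [Fintype A] [DecidableEq A]
    (G : MoEGame Θ Y A) (n : ℕ) : MoEGame (Fin n → Θ) (Fin n → Y) (Fin n → A) where
  prob θ := ∏ i, G.prob (θ i)
  prob_nonneg θ := Finset.prod_nonneg fun i _ => G.prob_nonneg (θ i)
  prob_sum := by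
    rw [← Fintype.prod_sum (fun (_ : Fin n) θ => G.prob θ)]
    simp [G.prob_sum]
  alice θ :=
    { op := fun y => tensorPiOp fun i => (G.alice (θ i)).op (y i)
      posSemidef := fun y => posSemidef_tensorPiOp _ fun i => (G.alice (θ i)).posSemidef (y i)
      sum_eq_one := sum_tensorPiOp (fun i => (G.alice (θ i)).op)
        fun i => (G.alice (θ i)).sum_eq_one }

/-- A purified strategy for a game: Bob's and Charlie's registers are `B` and `C`, their
measurements are projective, and the shared state is a unit vector of `A ⊗ B ⊗ C ⊗ R`, where no
player has access to the auxiliary register `R`. -/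
structure PurifiedStrategy {Θ Y A : Type*} [Fintype Θ] [Fintype Y] [DecidableEq Y] [Fintype A]
    [DecidableEq A] (G : MoEGame Θ Y A) (B C R : Type*) [Fintype B] [DecidableEq B]
    [Fintype C] [DecidableEq C] [Fintype R] where
  /-- Bob's measurement for each question. -/
  bob : Θ → POVM Y B
  /-- Charlie's measurement for each question. -/
  charlie : Θ → POVM Y C
  bob_projective : ∀ θ, (bob θ).IsProjective
  charlie_projective : ∀ θ, (charlie θ).IsProjective
  /-- The shared state. -/
  state : EuclideanSpace ℂ (A × B × C × R)
  norm_state : ‖state‖ = 1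

/-- The `i`-th winning probability of a strategy for the `n`-fold parallel repetition,
`𝔼_θ ∑_y Tr[(A^θ_{y,i} ⊗ B^θ_{y,i} ⊗ C^θ_{y,i} ⊗ 1_R) |ψ⟩⟨ψ|]`. -/
def PurifiedStrategy.roundWinProb {Θ Y A : Type*} [Fintype Θ] [Fintype Y] [DecidableEq Y]
    [Fintype A] [DecidableEq A] {G : MoEGame Θ Y A} {n : ℕ} {B C R : Type*} [Fintype B]
    [DecidableEq B] [Fintype C] [DecidableEq C] [Fintype R] [DecidableEq R]
    (S : PurifiedStrategy (G.parallel n) B C R) (i : Fin n) : ℝ :=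
  ∑ θ : Fin n → Θ, (G.parallel n).prob θ * ∑ y : Y,
    (Matrix.trace (((((G.parallel n).alice θ).marginal i).op y ⊗ₖ
      (((S.bob θ).marginal i).op y ⊗ₖ (((S.charlie θ).marginal i).op y ⊗ₖ
        (1 : Matrix R R ℂ)))) * ketbra S.state)).re

end Games

section TFKW

/-- The computational basis state `|y⟩` of a qubit. -/
def qubitKet (y : Fin 2) : EuclideanSpace ℂ (Fin 2) := EuclideanSpace.single y 1

/-- The Pauli operator `X`. -/
def pauliX : Matrix (Fin 2) (Fin 2) ℂ := !![0, 1; 1, 0]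

/-- The Pauli operator `Z`. -/
def pauliZ : Matrix (Fin 2) (Fin 2) ℂ := !![1, 0; 0, -1]

/-- The Hadamard operator. -/
def hadamardOp : Matrix (Fin 2) (Fin 2) ℂ :=
  ((1 / Real.sqrt 2 : ℝ) : ℂ) • !![1, 1; 1, -1]

/-- The conjugate-coding state `|y^θ⟩ = H^θ|y⟩`. -/
def conjugateCoding (y θ : Fin 2) : EuclideanSpace ℂ (Fin 2) :=
  ap (hadamardOp ^ (θ : ℕ)) (qubitKet y)

/-- The Breidbart operator. -/
def breidbartOp : Matrix (Fin 2) (Fin 2) ℂ :=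
  !![(Real.cos (Real.pi / 8) : ℂ), (Real.sin (Real.pi / 8) : ℂ);
     (Real.sin (Real.pi / 8) : ℂ), -(Real.cos (Real.pi / 8) : ℂ)]

/-- The Breidbart state `|β⟩`. -/
def breidbart : EuclideanSpace ℂ (Fin 2) := ap breidbartOp (qubitKet 0)

/-- The state `X^{s₀}Z^{s₁}|β⟩`. -/
def wiesnerBreidbart (s : Fin 2 → Fin 2) : EuclideanSpace ℂ (Fin 2) :=
  ap (pauliX ^ (s 0 : ℕ) * pauliZ ^ (s 1 : ℕ)) breidbart

theorem sum_ketbra_conjugateCoding (θ : Fin 2) :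
    ∑ y, ketbra (conjugateCoding y θ) = 1 := by
  have h2 : ((Real.sqrt 2 : ℝ) : ℂ)⁻¹ * ((Real.sqrt 2 : ℝ) : ℂ)⁻¹ = 1 / 2 := by
    rw [← mul_inv, ← Complex.ofReal_mul, Real.mul_self_sqrt (by norm_num)]
    norm_num
  fin_cases θ <;> ext a b <;> fin_cases a <;> fin_cases b <;>
    simp [ketbra, conjugateCoding, ap, qubitKet, hadamardOp, Matrix.vecMulVec_apply,
      Matrix.sum_apply, h2] <;> norm_num

/-- The TFKW game: a uniformly random question `θ`, for which Alice measures a qubit in the basis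
`|0^θ⟩, |1^θ⟩`. -/
def TFKW : MoEGame (Fin 2) (Fin 2) (Fin 2) where
  prob _ := 1 / 2
  prob_nonneg _ := by norm_num
  prob_sum := by norm_num
  alice θ :=
    { op := fun y => ketbra (conjugateCoding y θ)
      posSemidef := fun y => Matrix.posSemidef_vecMulVec_self_star _
      sum_eq_one := sum_ketbra_conjugateCoding θ }

/-- Bob's observable `^{φ,i}B_θ` for the `i`-th game: the observable of the `i`-th answer of his
measurement for the question string `φ + θ1^i`. -/
def PurifiedStrategy.bobObs {n : ℕ} {B C R : Type*} [Fintype B] [DecidableEq B] [Fintype C]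
    [DecidableEq C] [Fintype R] (S : PurifiedStrategy (TFKW.parallel n) B C R)
    (φ : Fin n → Fin 2) (i : Fin n) (θ : Fin 2) : Matrix B B ℂ :=
  ((S.bob (φ + Pi.single i θ)).marginal i).observable

/-- Charlie's observable `^{φ,i}C_θ` for the `i`-th game. -/
def PurifiedStrategy.charlieObs {n : ℕ} {B C R : Type*} [Fintype B] [DecidableEq B] [Fintype C]
    [DecidableEq C] [Fintype R] (S : PurifiedStrategy (TFKW.parallel n) B C R)
    (φ : Fin n → Fin 2) (i : Fin n) (θ : Fin 2) : Matrix C C ℂ :=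
  ((S.charlie (φ + Pi.single i θ)).marginal i).observable

end TFKW

section Supports

/-- The support on the first factor of a vector of `B ⊗ C ⊗ R`: the span of the vectors
`(1 ⊗ ⟨c| ⊗ ⟨r|)v`, which is the range of the reduced operator `Tr_{CR} |v⟩⟨v|`. -/
def supportBob {B C R : Type*} (v : EuclideanSpace ℂ (B × C × R)) :
    Submodule ℂ (EuclideanSpace ℂ B) :=
  Submodule.span ℂ (Set.range fun cr : C × R => WithLp.toLp 2 fun b => v (b, cr.1, cr.2))

/-- The support on the second factor of a vector of `B ⊗ C ⊗ R`: the span of the vectors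
`(⟨b| ⊗ 1 ⊗ ⟨r|)v`, which is the range of the reduced operator `Tr_{BR} |v⟩⟨v|`. -/
def supportCharlie {B C R : Type*} (v : EuclideanSpace ℂ (B × C × R)) :
    Submodule ℂ (EuclideanSpace ℂ C) :=
  Submodule.span ℂ (Set.range fun br : B × R => WithLp.toLp 2 fun c => v (br.1, c, br.2))

end Supports

section Extensions

/-- An operator on Bob's space, acting on `A ⊗ B ⊗ C ⊗ R`. -/
def onBob (A : Type*) {B' B : Type*} (C R : Type*) [DecidableEq A] [DecidableEq C]
    [DecidableEq R] (M : Matrix B' B ℂ) : Matrix (A × B' × C × R) (A × B × C × R) ℂ :=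
  (1 : Matrix A A ℂ) ⊗ₖ (M ⊗ₖ ((1 : Matrix C C ℂ) ⊗ₖ (1 : Matrix R R ℂ)))

/-- An operator on Charlie's space, acting on `A ⊗ B ⊗ C ⊗ R`. -/
def onCharlie (A B : Type*) {C' C : Type*} (R : Type*) [DecidableEq A] [DecidableEq B]
    [DecidableEq R] (M : Matrix C' C ℂ) : Matrix (A × B × C' × R) (A × B × C × R) ℂ :=
  (1 : Matrix A A ℂ) ⊗ₖ ((1 : Matrix B B ℂ) ⊗ₖ (M ⊗ₖ (1 : Matrix R R ℂ)))

/-- The state `∑_t X^{t₁₀}Z^{t₁₁}|β⟩ ⊗ ⋯ ⊗ X^{tₙ₀}Z^{tₙ₁}|β⟩ ⊗ |ψ_t⟩`. -/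
def breidbartSuperposition {n : ℕ} {B C R : Type*}
    (ψ : (Fin n → Fin 2 → Fin 2) → EuclideanSpace ℂ (B × C × R)) :
    EuclideanSpace ℂ ((Fin n → Fin 2) × B × C × R) :=
  ∑ t, tensorVec (tensorPiVec fun i => wiesnerBreidbart (t i)) (ψ t)

end Extensions

end

/-! Round `i` is won with a probability that is affine in the pairwise correlations of the three
players. After the questions of the other rounds are fixed by averaging
(`PurifiedStrategy.exists_le_roundValue`), the hypothesis bounds from below the expectation of (ZB₀
+ XC₁) + (ZC₀ + XB₁) + B₀C₀ + B₁C₁, where Z and X are Alice's Pauli operators. The reflections ZB₀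
and XC₁ anticommute, so their sum is at most √2; the four groups are at most √2, √2, 1, 1, and all
of them are nearly saturated. Up to O(√ε), Bob's and Charlie's observables thus agree on the state
ψ, and (ZB₀ + XC₁)ψ = √2 ψ.

The main point is that all observables of Bob, of the same round or of different ones, almost
commute on ψ (`IsRound.norm_commutator_le`). If S is one of them and T is Charlie's counterpart,
then Sψ is optimal up to O(ε) as well: S commutes with Charlie's terms, and T, which nearly agrees
with S on ψ, commutes with Bob's. Hence ψ and Sψ satisfy the same eigenvalue relation, in which S
commutes with everything except B₀.

Each player then measures all 2n observables in sequence and records the outcomes in a register.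
This is the isometry, and the recorded signs are exactly commuting observables. By
`l2norm_seqProj_apply_sub_le` every original observable acts as its recorded sign up to O(n√ε).
Consequently the two records almost agree, and on the record t the eigenvalue relation reads
((-1)^{t_{i0}} Z + (-1)^{t_{i1}} X)/√2 = 1, which characterizes the qubit state
X^{t_{i0}}Z^{t_{i1}}|β⟩. Projecting onto equal records (2n conditions) and onto these qubit states
(n conditions) costs O(n²√ε) in total; normalizing the projected vector gives the superposition. -/

noncomputable section

/-! ### Real parts of inner products -/

section RealInner

variable {H : Type*} [NormedAddCommGroup H] [InnerProductSpace ℂ H]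

/-- The real part of the inner product of a complex inner product space. -/
def reInner (x y : H) : ℝ := RCLike.re (inner ℂ x y)

theorem reInner_comm (x y : H) : reInner x y = reInner y x := inner_re_symm x y

theorem reInner_add_left (x y z : H) : reInner (x + y) z = reInner x z + reInner y z := by
  simp [reInner]

theorem reInner_add_right (x y z : H) : reInner x (y + z) = reInner x y + reInner x z := by
  simp [reInner]

theorem reInner_neg_right (x y : H) : reInner x (-y) = -reInner x y := by
  simp [reInner]

theorem reInner_sub_right (x y z : H) : reInner x (y - z) = reInner x y - reInner x z := by
  simp [reInner]

theorem reInner_smul_left (r : ℝ) (x y : H) : reInner ((r : ℂ) • x) y = r * reInner x y := by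
  simp [reInner]

theorem reInner_smul_right (r : ℝ) (x y : H) : reInner x ((r : ℂ) • y) = r * reInner x y := by
  simp [reInner]

theorem reInner_self (x : H) : reInner x x = ‖x‖ ^ 2 := (norm_sq_eq_re_inner (𝕜 := ℂ) x).symm

theorem norm_sub_sq_reInner (x y : H) : ‖x - y‖ ^ 2 = ‖x‖ ^ 2 - 2 * reInner x y + ‖y‖ ^ 2 :=
  norm_sub_sq (𝕜 := ℂ) x y

theorem norm_add_sq_reInner (x y : H) : ‖x + y‖ ^ 2 = ‖x‖ ^ 2 + 2 * reInner x y + ‖y‖ ^ 2 :=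
  norm_add_sq (𝕜 := ℂ) x y

theorem abs_reInner_le (x y : H) : |reInner x y| ≤ ‖x‖ * ‖y‖ :=
  (RCLike.abs_re_le_norm _).trans (norm_inner_le_norm x y)

theorem commute_apply {S T : H →L[ℂ] H} (h : Commute S T) (x : H) : S (T x) = T (S x) := by
  simpa using congrArg (fun U : H →L[ℂ] H => U x) h.eq

end RealInner

/-! ### Near-optimal states of a single round -/

section Reflections

variable {H : Type*} [NormedAddCommGroup H] [InnerProductSpace ℂ H] [CompleteSpace H]

/-- A self-adjoint operator with square `1`. -/
structure IsReflection (T : H →L[ℂ] H) : Prop where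
  isSelfAdjoint : IsSelfAdjoint T
  mul_self : T * T = 1

namespace IsReflection

variable {S T : H →L[ℂ] H}

theorem apply_apply (hT : IsReflection T) (x : H) : T (T x) = x := by
  simpa using congrArg (fun U : H →L[ℂ] H => U x) hT.mul_self

theorem reInner_left (hT : IsReflection T) (x y : H) : reInner (T x) y = reInner x (T y) :=
  congrArg RCLike.re (hT.isSelfAdjoint.isSymmetric x y)

theorem norm_apply (hT : IsReflection T) (x : H) : ‖T x‖ = ‖x‖ := by
  have h : ‖T x‖ ^ 2 = ‖x‖ ^ 2 := by
    rw [← reInner_self, hT.reInner_left, hT.apply_apply, reInner_self]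
  exact (sq_eq_sq₀ (norm_nonneg _) (norm_nonneg _)).mp h

theorem mul (hS : IsReflection S) (hT : IsReflection T) (h : Commute S T) :
    IsReflection (S * T) where
  isSelfAdjoint := hS.isSelfAdjoint.commute_iff hT.isSelfAdjoint |>.mp h
  mul_self := by
    rw [mul_assoc, ← mul_assoc T, ← h.eq, mul_assoc, hT.mul_self, mul_one, hS.mul_self]

end IsReflection

/-- The product PQ is skew-adjoint, so its expectation is purely imaginary. -/
theorem reInner_eq_zero_of_anticommute {P Q : H →L[ℂ] H} (hP : IsReflection P)
    (hQ : IsReflection Q) (h : P * Q = -(Q * P)) (x : H) : reInner (P x) (Q x) = 0 := by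
  have h1 : P (Q x) = -Q (P x) := by
    simpa using congrArg (fun U : H →L[ℂ] H => U x) h
  have h2 := hP.reInner_left x (Q x)
  rw [h1, reInner_neg_right, ← hQ.reInner_left x, reInner_comm (Q x)] at h2
  linarith

/-- The sum of two anticommuting reflections has norm at most `√2`, as a sum of squares. -/
theorem norm_sub_sq_of_anticommute {P Q : H →L[ℂ] H} (hP : IsReflection P) (hQ : IsReflection Q)
    (h : P * Q = -(Q * P)) (x : H) :
    ‖((√2 : ℝ) : ℂ) • x - (P x + Q x)‖ ^ 2 =
      2 * √2 * (√2 * ‖x‖ ^ 2 - (reInner x (P x) + reInner x (Q x))) := by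
  have h0 := reInner_eq_zero_of_anticommute hP hQ h x
  have h2 : √2 * √2 = 2 := Real.mul_self_sqrt (by norm_num)
  rw [norm_sub_sq_reInner, norm_add_sq_reInner, h0, hP.norm_apply, hQ.norm_apply, norm_smul,
    mul_pow, reInner_smul_left, reInner_add_right, Complex.norm_real, Real.norm_eq_abs, sq_abs]
  linear_combination (-‖x‖ ^ 2) * h2

theorem norm_sub_sq_of_reflection {S T : H →L[ℂ] H} (hS : IsReflection S) (hT : IsReflection T)
    (x : H) : ‖S x - T x‖ ^ 2 = 2 * (‖x‖ ^ 2 - reInner x (S (T x))) := by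
  rw [norm_sub_sq_reInner, hS.norm_apply, hT.norm_apply, hS.reInner_left]
  ring

/-- The observables of one round of the game, and a state `ψ` that wins it with probability
at least `cos² (π/8) - ε`. -/
structure IsRound (Z X B₀ B₁ C₀ C₁ : H →L[ℂ] H) (ψ : H) (ε : ℝ) : Prop where
  hZ : IsReflection Z
  hX : IsReflection X
  hB₀ : IsReflection B₀
  hB₁ : IsReflection B₁
  hC₀ : IsReflection C₀
  hC₁ : IsReflection C₁
  anti : Z * X = -(X * Z)
  ZB₀ : Commute Z B₀
  ZB₁ : Commute Z B₁
  ZC₀ : Commute Z C₀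
  ZC₁ : Commute Z C₁
  XB₀ : Commute X B₀
  XB₁ : Commute X B₁
  XC₀ : Commute X C₀
  XC₁ : Commute X C₁
  BC₀₀ : Commute B₀ C₀
  BC₀₁ : Commute B₀ C₁
  BC₁₀ : Commute B₁ C₀
  BC₁₁ : Commute B₁ C₁
  norm_state : ‖ψ‖ = 1
  -- The correlations are grouped so that the lines are at most √2, √2 and 2. The factor 8 comes
  -- from the average over two questions and the factor 1/4 between correlations and probability.
  value : 2 + 2 * √2 - 8 * ε ≤ reInner ψ (Z (B₀ ψ)) + reInner ψ (X (C₁ ψ)) +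
    (reInner ψ (Z (C₀ ψ)) + reInner ψ (X (B₁ ψ))) +
    (reInner ψ (B₀ (C₀ ψ)) + reInner ψ (B₁ (C₁ ψ)))

namespace IsRound

variable {Z X B₀ B₁ C₀ C₁ : H →L[ℂ] H} {ψ : H} {ε : ℝ}

/-- With `swap_players`, this symmetry lets each estimate be proved for one question and one player
only. -/
theorem swap_questions (h : IsRound Z X B₀ B₁ C₀ C₁ ψ ε) : IsRound X Z B₁ B₀ C₁ C₀ ψ ε where
  hZ := h.hX
  hX := h.hZ
  hB₀ := h.hB₁
  hB₁ := h.hB₀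
  hC₀ := h.hC₁
  hC₁ := h.hC₀
  anti := by rw [h.anti, neg_neg]
  ZB₀ := h.XB₁
  ZB₁ := h.XB₀
  ZC₀ := h.XC₁
  ZC₁ := h.XC₀
  XB₀ := h.ZB₁
  XB₁ := h.ZB₀
  XC₀ := h.ZC₁
  XC₁ := h.ZC₀
  BC₀₀ := h.BC₁₁
  BC₀₁ := h.BC₁₀
  BC₁₀ := h.BC₀₁
  BC₁₁ := h.BC₀₀
  norm_state := h.norm_state
  value := by linarith [h.value]

theorem swap_players (h : IsRound Z X B₀ B₁ C₀ C₁ ψ ε) : IsRound Z X C₀ C₁ B₀ B₁ ψ ε where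
  hZ := h.hZ
  hX := h.hX
  hB₀ := h.hC₀
  hB₁ := h.hC₁
  hC₀ := h.hB₀
  hC₁ := h.hB₁
  anti := h.anti
  ZB₀ := h.ZC₀
  ZB₁ := h.ZC₁
  ZC₀ := h.ZB₀
  ZC₁ := h.ZB₁
  XB₀ := h.XC₀
  XB₁ := h.XC₁
  XC₀ := h.XB₀
  XC₁ := h.XB₁
  BC₀₀ := h.BC₀₀.symm
  BC₀₁ := h.BC₁₀.symm
  BC₁₀ := h.BC₀₁.symm
  BC₁₁ := h.BC₁₁.symm
  norm_state := h.norm_state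
  value := by
    rw [commute_apply h.BC₀₀.symm, commute_apply h.BC₁₁.symm]
    linarith [h.value]

/-- B₀ and C₁ belong to different players and commute, so the products inherit the anticommutation
of Z and X. B₀ and B₁ need not commute; hence the pairing of one player's observable for one
question with the other player's for the other question. -/
theorem anti_mixed (h : IsRound Z X B₀ B₁ C₀ C₁ ψ ε) :
    (Z * B₀) * (X * C₁) = -((X * C₁) * (Z * B₀)) := by
  calc (Z * B₀) * (X * C₁) = Z * X * (B₀ * C₁) := by
        rw [mul_assoc, ← mul_assoc B₀, ← h.XB₀.eq, mul_assoc, mul_assoc]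
    _ = -((X * C₁) * (Z * B₀)) := by
        rw [h.anti, h.BC₀₁.eq, neg_mul, mul_assoc, ← mul_assoc Z, h.ZC₁.eq, mul_assoc, mul_assoc]

/-- The defect of a vector for the mixed operator `Z B₀ + X C₁`. -/
theorem norm_mixed_sq (h : IsRound Z X B₀ B₁ C₀ C₁ ψ ε) (x : H) :
    ‖((√2 : ℝ) : ℂ) • x - (Z (B₀ x) + X (C₁ x))‖ ^ 2 =
      2 * √2 * (√2 * ‖x‖ ^ 2 - (reInner x (Z (B₀ x)) + reInner x (X (C₁ x)))) :=
  norm_sub_sq_of_anticommute (h.hZ.mul h.hB₀ h.ZB₀) (h.hX.mul h.hC₁ h.XC₁) h.anti_mixed x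

theorem sqrt_two_le : √2 ≤ 1.42 := by
  rw [Real.sqrt_le_left (by norm_num)]
  norm_num

theorem mixed_le (h : IsRound Z X B₀ B₁ C₀ C₁ ψ ε) (x : H) :
    reInner x (Z (B₀ x)) + reInner x (X (C₁ x)) ≤ √2 * ‖x‖ ^ 2 := by
  have h1 := h.norm_mixed_sq x
  have h2 : 0 < 2 * √2 := by positivity
  have h3 := sq_nonneg ‖((√2 : ℝ) : ℂ) • x - (Z (B₀ x) + X (C₁ x))‖
  rw [h1] at h3
  linarith [nonneg_of_mul_nonneg_right h3 h2]

theorem players_le (h : IsRound Z X B₀ B₁ C₀ C₁ ψ ε) : reInner ψ (B₀ (C₀ ψ)) ≤ 1 := by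
  have h1 := norm_sub_sq_of_reflection h.hB₀ h.hC₀ ψ
  rw [h.norm_state] at h1
  nlinarith [sq_nonneg ‖B₀ ψ - C₀ ψ‖]

/-- The four groups in the value have the upper bounds √2, √2, 1, 1, whose sum is the optimum, so
each is within 8ε of its bound. The squared distance is twice the deficit of B₀C₀. -/
theorem norm_players_sq_le (h : IsRound Z X B₀ B₁ C₀ C₁ ψ ε) : ‖B₀ ψ - C₀ ψ‖ ^ 2 ≤ 16 * ε := by
  have h1 := norm_sub_sq_of_reflection h.hB₀ h.hC₀ ψ
  have h2 := h.mixed_le ψ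
  have h3 := h.swap_players.mixed_le ψ
  have h4 := h.swap_questions.players_le
  have h5 := h.value
  rw [h.norm_state] at h1 h2 h3
  linarith

theorem norm_mixed_sq_le (h : IsRound Z X B₀ B₁ C₀ C₁ ψ ε) :
    ‖((√2 : ℝ) : ℂ) • ψ - (Z (B₀ ψ) + X (C₁ ψ))‖ ^ 2 ≤ 16 * √2 * ε := by
  have h1 := h.norm_mixed_sq ψ
  have h2 := h.players_le
  have h3 := h.swap_players.mixed_le ψ
  have h4 := h.swap_questions.players_le
  have h5 := h.value
  rw [h.norm_state] at h1 h3
  rw [h1]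
  have h6 : 0 < √2 := by positivity
  nlinarith

theorem eps_nonneg (h : IsRound Z X B₀ B₁ C₀ C₁ ψ ε) : 0 ≤ ε := by
  have := h.norm_players_sq_le
  nlinarith [sq_nonneg ‖B₀ ψ - C₀ ψ‖]

theorem le_of_sq_le {x k ε : ℝ} (hk : 0 ≤ k) (hε : 0 ≤ ε) (h : x ^ 2 ≤ k ^ 2 * ε) :
    x ≤ k * √ε := by
  refine le_of_sq_le_sq ?_ (by positivity)
  rw [mul_pow, Real.sq_sqrt hε]
  exact h

theorem norm_players_le (h : IsRound Z X B₀ B₁ C₀ C₁ ψ ε) : ‖B₀ ψ - C₀ ψ‖ ≤ 4 * √ε :=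
  le_of_sq_le (by norm_num) h.eps_nonneg (by linarith [h.norm_players_sq_le])

theorem norm_mixed_le (h : IsRound Z X B₀ B₁ C₀ C₁ ψ ε) :
    ‖((√2 : ℝ) : ℂ) • ψ - (Z (B₀ ψ) + X (C₁ ψ))‖ ≤ 5 * √ε :=
  le_of_sq_le (by norm_num) h.eps_nonneg
    (by nlinarith [h.norm_mixed_sq_le, sqrt_two_le, h.eps_nonneg])

/-- The agreement of the players on the state turns the mixed relation into one for Bob alone, at
the cost 5 + 4. -/
theorem norm_bob_le (h : IsRound Z X B₀ B₁ C₀ C₁ ψ ε) :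
    ‖((√2 : ℝ) : ℂ) • ψ - (Z (B₀ ψ) + X (B₁ ψ))‖ ≤ 9 * √ε := by
  have h1 : ((√2 : ℝ) : ℂ) • ψ - (Z (B₀ ψ) + X (B₁ ψ)) =
      (((√2 : ℝ) : ℂ) • ψ - (Z (B₀ ψ) + X (C₁ ψ))) - X (B₁ ψ - C₁ ψ) := by
    rw [map_sub]
    abel
  rw [h1]
  refine (norm_sub_le _ _).trans ?_
  rw [h.hX.norm_apply]
  linarith [h.norm_mixed_le, h.swap_questions.norm_players_le]

/-- If `S` and `T` are observables of Bob and Charlie that agree on the state, then `S ψ` is also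
nearly optimal for the round. -/
theorem value_apply (h : IsRound Z X B₀ B₁ C₀ C₁ ψ ε) {S T : H →L[ℂ] H} (hS : IsReflection S)
    (hT : IsReflection T) (hZS : Commute Z S) (hXS : Commute X S) (hSC₀ : Commute S C₀)
    (hSC₁ : Commute S C₁) (hZT : Commute Z T) (hXT : Commute X T) (hTB₀ : Commute B₀ T)
    (hTB₁ : Commute B₁ T) (hST : ‖S ψ - T ψ‖ ≤ 4 * √ε) :
    2 * √2 - 136 * ε ≤ reInner (S ψ) (Z (B₀ (S ψ))) + reInner (S ψ) (X (B₁ (S ψ))) +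
      (reInner (S ψ) (Z (C₀ (S ψ))) + reInner (S ψ) (X (C₁ (S ψ)))) := by
  have hε := h.eps_nonneg
  -- Charlie's half of the value is unchanged, since S commutes with it and squares to 1. For Bob's
  -- half N, the vector Sψ is compared with Tψ, where T commutes with N.
  have eC₀ : reInner (S ψ) (Z (C₀ (S ψ))) = reInner ψ (Z (C₀ ψ)) := by
    rw [commute_apply hSC₀.symm, commute_apply hZS, hS.reInner_left, hS.apply_apply]
  have eC₁ : reInner (S ψ) (X (C₁ (S ψ))) = reInner ψ (X (C₁ ψ)) := by
    rw [commute_apply hSC₁.symm, commute_apply hXS, hS.reInner_left, hS.apply_apply]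
  set η := S ψ - T ψ with hη
  set ξ := ((√2 : ℝ) : ℂ) • ψ - (Z (B₀ ψ) + X (B₁ ψ)) with hξ
  set N : H → H := fun x => Z (B₀ x) + X (B₁ x) with hN
  have hNadd : ∀ x y, N (x + y) = N x + N y := fun x y => by
    simp only [hN, map_add]
    abel
  have hNsymm : ∀ x y, reInner (N x) y = reInner x (N y) := fun x y => by
    simp only [hN, reInner_add_left, reInner_add_right, h.hZ.reInner_left, h.hX.reInner_left,
      h.hB₀.reInner_left, h.hB₁.reInner_left]
    rw [commute_apply h.ZB₀, commute_apply h.XB₁]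
  have hNT : N (T ψ) = T (N ψ) := by
    simp only [hN, map_add]
    rw [commute_apply hTB₀, commute_apply hTB₁, commute_apply hZT, commute_apply hXT]
  have hNψ : N ψ = ((√2 : ℝ) : ℂ) • ψ - ξ := by
    simp only [hN, hξ]
    abel
  have hSη : S ψ = T ψ + η := by
    rw [hη]
    abel
  -- Sψ and Tψ have equal norms, so η is orthogonal to Tψ up to second order. As N Tψ is nearly √2
  -- Tψ, the first-order term in η has size O(ε) instead of O(√ε).
  have hηT : reInner η (T ψ) = -(‖η‖ ^ 2 / 2) := by
    have h1 := congrArg (fun x => ‖x‖ ^ 2) hSη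
    simp only [norm_add_sq_reInner, hS.norm_apply, hT.norm_apply] at h1
    rw [reInner_comm]
    linarith
  have e1 : reInner (S ψ) (N (S ψ)) = reInner (T ψ) (N (T ψ)) + 2 * reInner η (N (T ψ)) +
      reInner η (N η) := by
    rw [hSη, hNadd, reInner_add_left, reInner_add_right (T ψ), reInner_add_right η,
      ← hNsymm (T ψ) η, reInner_comm (N (T ψ)) η]
    ring
  have e2 : reInner (T ψ) (N (T ψ)) = reInner ψ (N ψ) := by
    rw [hNT, hT.reInner_left, hT.apply_apply]
  have e3 : reInner η (N (T ψ)) = √2 * reInner η (T ψ) - reInner η (T ξ) := by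
    rw [hNT, hNψ, map_sub, map_smul, reInner_sub_right, reInner_smul_right]
  have b1 : |reInner η (T ξ)| ≤ 4 * √ε * (9 * √ε) :=
    (abs_reInner_le _ _).trans (mul_le_mul hST (by rw [hT.norm_apply]; exact h.norm_bob_le)
      (norm_nonneg _) (by positivity))
  have b2 : |reInner η (N η)| ≤ ‖η‖ * (2 * ‖η‖) := by
    refine (abs_reInner_le _ _).trans (mul_le_mul_of_nonneg_left ?_ (norm_nonneg _))
    refine (norm_add_le _ _).trans ?_
    rw [h.hZ.norm_apply, h.hX.norm_apply, h.hB₀.norm_apply, h.hB₁.norm_apply]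
    linarith
  have b3 : ‖η‖ ^ 2 ≤ 16 * ε := by
    have := pow_le_pow_left₀ (norm_nonneg _) hST 2
    rw [mul_pow, Real.sq_sqrt hε] at this
    linarith
  have hsq : √ε * √ε = ε := Real.mul_self_sqrt hε
  have b4 := h.players_le
  have b5 := h.swap_questions.players_le
  have b6 := h.value
  have b7 : reInner ψ (N ψ) = reInner ψ (Z (B₀ ψ)) + reInner ψ (X (B₁ ψ)) := reInner_add_right _ _ _
  have b8 : reInner (S ψ) (N (S ψ)) =
      reInner (S ψ) (Z (B₀ (S ψ))) + reInner (S ψ) (X (B₁ (S ψ))) := reInner_add_right _ _ _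
  rw [eC₀, eC₁, ← b8, e1, e2, e3, hηT, b7]
  have c1 := (abs_le.mp b1).2
  have c2 := (abs_le.mp b2).1
  have c3 : √2 * ‖η‖ ^ 2 ≤ 1.42 * (16 * ε) :=
    mul_le_mul sqrt_two_le b3 (by positivity) (by norm_num)
  have c4 : 4 * √ε * (9 * √ε) = 36 * ε := by linear_combination 36 * hsq
  -- The losses are 8ε from the value, 1.42 · 16ε and 2 · 36ε from the first-order term, and 2 · 16ε
  -- from the second-order term, less than 136ε together.
  nlinarith

/-- Both ψ and Sψ are nearly eigenvectors of ZB₀ + XC₁ for the eigenvalue √2. Applying S to the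
relation for ψ and subtracting the one for Sψ leaves only the commutator with B₀, because S commutes
with Z, X and C₁. This is why the mixed operator is used and not ZB₀ + XB₁. -/
theorem norm_commutator_le (h : IsRound Z X B₀ B₁ C₀ C₁ ψ ε) {S T : H →L[ℂ] H}
    (hS : IsReflection S)
    (hT : IsReflection T) (hZS : Commute Z S) (hXS : Commute X S) (hSC₀ : Commute S C₀)
    (hSC₁ : Commute S C₁) (hZT : Commute Z T) (hXT : Commute X T) (hTB₀ : Commute B₀ T)
    (hTB₁ : Commute B₁ T) (hST : ‖S ψ - T ψ‖ ≤ 4 * √ε) :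
    ‖B₀ (S ψ) - S (B₀ ψ)‖ ≤ 25 * √ε := by
  have hε := h.eps_nonneg
  have h1 := h.value_apply hS hT hZS hXS hSC₀ hSC₁ hZT hXT hTB₀ hTB₁ hST
  have h2 := h.swap_players.mixed_le (S ψ)
  have h3 := h.norm_mixed_sq (S ψ)
  rw [hS.norm_apply, h.norm_state] at h2 h3
  -- The other mixed pair is at most √2, so this one has deficit at most 136ε, and 2 · 1.42 · 136 ≤
  -- 20².
  have h4 : ‖((√2 : ℝ) : ℂ) • S ψ - (Z (B₀ (S ψ)) + X (C₁ (S ψ)))‖ ≤ 20 * √ε := by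
    refine le_of_sq_le (by norm_num) hε ?_
    rw [h3]
    have h6 : 0 < √2 := by positivity
    have h7 : √2 * 1 ^ 2 - (reInner (S ψ) (Z (B₀ (S ψ))) + reInner (S ψ) (X (C₁ (S ψ)))) ≤
      136 * ε := by linarith
    have h8 := sqrt_two_le
    calc _ ≤ 2 * √2 * (136 * ε) := mul_le_mul_of_nonneg_left h7 (by positivity)
      _ ≤ 2 * 1.42 * (136 * ε) := by gcongr
      _ ≤ _ := by nlinarith
  have h5 : Z (B₀ (S ψ) - S (B₀ ψ)) = S (((√2 : ℝ) : ℂ) • ψ - (Z (B₀ ψ) + X (C₁ ψ))) -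
      (((√2 : ℝ) : ℂ) • S ψ - (Z (B₀ (S ψ)) + X (C₁ (S ψ)))) := by
    simp only [map_sub, map_add, map_smul]
    rw [commute_apply hZS, ← commute_apply hXS, commute_apply hSC₁]
    abel
  rw [← h.hZ.norm_apply, h5]
  refine (norm_sub_le _ _).trans ?_
  rw [hS.norm_apply]
  have := h.norm_mixed_le
  linarith [Real.sqrt_nonneg ε]

end IsRound

end Reflections

/-! ### Norms of finite families of vectors -/

section Families

variable {ι H : Type*} [Fintype ι] [NormedAddCommGroup H]

/-- The `ℓ²` norm of a finite family of vectors. -/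
def l2norm (f : ι → H) : ℝ := ‖(WithLp.toLp 2 f : PiLp 2 fun _ : ι => H)‖

theorem l2norm_sq (f : ι → H) : l2norm f ^ 2 = ∑ i, ‖f i‖ ^ 2 :=
  PiLp.norm_sq_eq_of_L2 _ _

theorem l2norm_nonneg (f : ι → H) : 0 ≤ l2norm f := norm_nonneg _

theorem l2norm_add_le (f g : ι → H) : l2norm (fun i => f i + g i) ≤ l2norm f + l2norm g :=
  norm_add_le (WithLp.toLp 2 f : PiLp 2 fun _ : ι => H) (WithLp.toLp 2 g)

theorem l2norm_sub_le_add (f g h : ι → H) :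
    l2norm (fun i => f i - h i) ≤ l2norm (fun i => f i - g i) + l2norm (fun i => g i - h i) := by
  simpa using l2norm_add_le (fun i => f i - g i) (fun i => g i - h i)

theorem l2norm_le_of_sum_le {f : ι → H} {r : ℝ} (hr : 0 ≤ r) (h : ∑ i, ‖f i‖ ^ 2 ≤ r ^ 2) :
    l2norm f ≤ r :=
  le_of_sq_le_sq (by rw [l2norm_sq]; exact h) hr

theorem l2norm_mono {K : Type*} [NormedAddCommGroup K] {f : ι → H} {g : ι → K}
    (h : ∀ i, ‖f i‖ ≤ ‖g i‖) : l2norm f ≤ l2norm g :=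
  l2norm_le_of_sum_le (l2norm_nonneg _) (by
    rw [l2norm_sq]
    exact Finset.sum_le_sum fun i _ => pow_le_pow_left₀ (norm_nonneg _) (h i) 2)

theorem l2norm_smul [NormedSpace ℂ H] (r : ℂ) (f : ι → H) :
    l2norm (fun i => r • f i) = ‖r‖ * l2norm f :=
  norm_smul r (WithLp.toLp 2 f : PiLp 2 fun _ : ι => H)

theorem l2norm_sub_comm (f g : ι → H) :
    l2norm (fun i => f i - g i) = l2norm (fun i => g i - f i) :=
  norm_sub_rev (WithLp.toLp 2 f : PiLp 2 fun _ : ι => H) (WithLp.toLp 2 g)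

theorem norm_neg_one_pow_smul {H : Type*} [NormedAddCommGroup H] [NormedSpace ℂ H] (k : ℕ)
    (x : H) : ‖(-1 : ℂ) ^ k • x‖ = ‖x‖ := by
  simp [norm_smul]

end Families

/-! ### Sequential measurement of almost commuting reflections -/

section SequentialProjections

variable {𝓐 : Type*} [Ring 𝓐] [Algebra ℂ 𝓐]

/-- The projector onto the eigenspace of the eigenvalue `(-1)^s` of a reflection. -/
def signProj (T : 𝓐) (s : Fin 2) : 𝓐 := (1 / 2 : ℂ) • (1 + (-1 : ℂ) ^ (s : ℕ) • T)

/-- The product of the spectral projectors of a sequence of reflections, for the signs `t`; the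
first of them is applied first. -/
def seqProj : {m : ℕ} → (Fin m → 𝓐) → (Fin m → Fin 2) → 𝓐
  | 0, _, _ => 1
  | _ + 1, T, t => seqProj (Fin.tail T) (Fin.tail t) * signProj (T 0) (t 0)

theorem map_signProj {𝓑 F : Type*} [Ring 𝓑] [Algebra ℂ 𝓑] [FunLike F 𝓐 𝓑]
    [AlgHomClass F ℂ 𝓐 𝓑] (f : F) (T : 𝓐) (s : Fin 2) :
    f (signProj T s) = signProj (f T) s := by
  simp [signProj]

/-- Relates the sequential measurement as a matrix on one register, from which the isometry is
built, to the operator on the whole space, for which the estimates are proved. -/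
theorem map_seqProj {𝓑 F : Type*} [Ring 𝓑] [Algebra ℂ 𝓑] [FunLike F 𝓐 𝓑]
    [AlgHomClass F ℂ 𝓐 𝓑] (f : F) {m : ℕ}
    (T : Fin m → 𝓐) (t : Fin m → Fin 2) :
    f (seqProj T t) = seqProj (fun k => f (T k)) t := by
  induction m with
  | zero => simp [seqProj]
  | succ m ih =>
    simp only [seqProj, map_mul, ih, map_signProj]
    rfl

theorem Commute.signProj_right {S T : 𝓐} (h : Commute S T) (s : Fin 2) :
    Commute S (signProj T s) :=
  ((Commute.one_right _).add_right (h.smul_right _)).smul_right _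

theorem Commute.seqProj_right {S : 𝓐} {m : ℕ} {T : Fin m → 𝓐} (h : ∀ k, Commute S (T k))
    (t : Fin m → Fin 2) : Commute S (seqProj T t) := by
  induction m with
  | zero => exact Commute.one_right _
  | succ m ih => exact (ih (fun k => h k.succ) _).mul_right ((h 0).signProj_right _)

theorem sum_fin_succ_arrow {M Y : Type*} [AddCommMonoid M] [Fintype Y] {m : ℕ}
    (F : (Fin (m + 1) → Y) → M) : ∑ t, F t = ∑ s, ∑ t : Fin m → Y, F (Fin.cons s t) := by
  rw [← (Fin.consEquiv fun _ => Y).sum_comp, Fintype.sum_prod_type]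
  rfl

variable {H : Type*} [NormedAddCommGroup H] [InnerProductSpace ℂ H]

theorem signProj_apply (T : H →L[ℂ] H) (s : Fin 2) (x : H) :
    signProj T s x = (1 / 2 : ℂ) • (x + (-1 : ℂ) ^ (s : ℕ) • T x) := by
  simp [signProj]

/-- For either sign the difference is ±(S - T)x/2, so the two squares add up to half of the squared
distance. -/
theorem l2norm_signProj_sub_le {S T : H →L[ℂ] H} {x : H} {δ : ℝ} (hδ : 0 ≤ δ)
    (h : ‖S x - T x‖ ≤ δ) : l2norm (fun s => signProj S s x - signProj T s x) ≤ δ := by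
  refine l2norm_le_of_sum_le hδ ?_
  have h1 : ∀ s, signProj S s x - signProj T s x =
      (1 / 2 : ℂ) • (-1 : ℂ) ^ (s : ℕ) • (S x - T x) := fun s => by
    rw [signProj_apply, signProj_apply]
    module
  simp only [h1, norm_smul (1 / 2 : ℂ), norm_neg_one_pow_smul, Fin.sum_univ_two]
  norm_num
  nlinarith [norm_nonneg (S x - T x)]

theorem l2norm_signProj_commutator_le {S T : H →L[ℂ] H} {x : H} {δ : ℝ} (hδ : 0 ≤ δ)
    (h : ‖S (T x) - T (S x)‖ ≤ δ) :
    l2norm (fun s => signProj S s (T x) - T (signProj S s x)) ≤ δ := by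
  refine l2norm_le_of_sum_le hδ ?_
  have h1 : ∀ s, signProj S s (T x) - T (signProj S s x) =
      (1 / 2 : ℂ) • (-1 : ℂ) ^ (s : ℕ) • (S (T x) - T (S x)) := fun s => by
    rw [signProj_apply, signProj_apply, map_smul, map_add, map_smul]
    module
  simp only [h1, norm_smul (1 / 2 : ℂ), norm_neg_one_pow_smul, Fin.sum_univ_two]
  norm_num
  nlinarith [norm_nonneg (S (T x) - T (S x))]

variable [CompleteSpace H]

theorem sum_norm_signProj {T : H →L[ℂ] H} (hT : IsReflection T) (x : H) :
    ∑ s, ‖signProj T s x‖ ^ 2 = ‖x‖ ^ 2 := by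
  simp only [Fin.sum_univ_two, signProj_apply, norm_smul, mul_pow]
  simp only [Fin.val_zero, Fin.val_one, pow_zero, pow_one, one_smul, neg_smul, ← sub_eq_add_neg]
  rw [norm_add_sq_reInner, norm_sub_sq_reInner, hT.norm_apply]
  norm_num
  ring

theorem signProj_apply_self {T : H →L[ℂ] H} (hT : IsReflection T) (s : Fin 2) (x : H) :
    signProj T s (T x) = (-1 : ℂ) ^ (s : ℕ) • signProj T s x := by
  fin_cases s <;> simp only [signProj_apply, hT.apply_apply, Fin.zero_eta, Fin.mk_one,
    Fin.val_zero, Fin.val_one, pow_zero, pow_one] <;> module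

/-- Pythagoras, one measurement at a time; the reflections need not commute. -/
theorem sum_norm_seqProj {m : ℕ} {T : Fin m → H →L[ℂ] H} (hT : ∀ k, IsReflection (T k)) (x : H) :
    ∑ t, ‖seqProj T t x‖ ^ 2 = ‖x‖ ^ 2 := by
  induction m generalizing x with
  | zero => simp [seqProj]
  | succ m ih =>
    simp only [sum_fin_succ_arrow, seqProj, Fin.tail_cons, Fin.cons_zero,
      mul_apply_eq_comp]
    rw [← sum_norm_signProj (hT 0)]
    exact Finset.sum_congr rfl fun s _ => ih (fun k => hT k.succ) _

/-- The vector measured by the tail may depend on the first outcome, so an error made in the first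
measurement is not amplified by the later ones. -/
theorem sum_norm_seqProj_cons {m : ℕ} {T : Fin m → H →L[ℂ] H} (hT : ∀ k, IsReflection (T k))
    (x : Fin 2 → H) :
    ∑ t : Fin (m + 1) → Fin 2, ‖seqProj T (Fin.tail t) (x (t 0))‖ ^ 2 = ∑ s, ‖x s‖ ^ 2 := by
  simp only [sum_fin_succ_arrow, Fin.tail_cons, Fin.cons_zero, sum_norm_seqProj hT]

/-- The sequential measurement of reflections that almost commute on a state intertwines each of
them with a sign, up to a small error. -/
theorem l2norm_seqProj_apply_sub_le {m : ℕ} {b c : Fin m → H →L[ℂ] H}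
    (hb : ∀ k, IsReflection (b k)) (hc : ∀ k, IsReflection (c k))
    (hbc : ∀ j k, Commute (b j) (c k)) {ψ : H} {δ δ' : ℝ} (hδ : 0 ≤ δ) (hδ' : 0 ≤ δ')
    (hψ : ∀ k, ‖b k ψ - c k ψ‖ ≤ δ) (hcomm : ∀ j k, ‖b j (b k ψ) - b k (b j ψ)‖ ≤ δ') (k : Fin m) :
    l2norm (fun t => seqProj b t (b k ψ) - (-1 : ℂ) ^ (t k : ℕ) • seqProj b t ψ) ≤
      m * (δ' + 2 * δ) := by
  induction m with
  | zero => exact k.elim0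
  | succ m ih =>
    have hT : ∀ j, IsReflection (Fin.tail b j) := fun j => hb j.succ
    cases k using Fin.cases with
    | zero =>
      have h0 : ∀ t : Fin (m + 1) → Fin 2,
          seqProj b t (b 0 ψ) - (-1 : ℂ) ^ (t 0 : ℕ) • seqProj b t ψ = 0 := fun t => by
        simp only [seqProj, mul_apply_eq_comp, signProj_apply_self (hb 0), map_smul,
          sub_self]
      refine l2norm_le_of_sum_le (by positivity) ?_
      simp only [h0]
      simp
      positivity
    | succ j =>
      have ih' := ih (fun i => hb i.succ) (fun i => hc i.succ) (fun i l => hbc i.succ l.succ)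
        (fun i => hψ i.succ) (fun i l => hcomm i.succ l.succ) j
      set F := fun t : Fin (m + 1) → Fin 2 => seqProj (Fin.tail b) (Fin.tail t) with hF
      have key : ∀ x : Fin 2 → H, l2norm (fun t => F t (x (t 0))) = l2norm x := fun x =>
        (sq_eq_sq₀ (l2norm_nonneg _) (l2norm_nonneg _)).mp (by
          rw [l2norm_sq, l2norm_sq]; exact sum_norm_seqProj_cons hT x)
      -- The induction hypothesis concerns ψ, not the state after the first measurement. So the
      -- observable is moved past Bob's first projector (error δ'), this projector is exchanged for
      -- Charlie's (error δ), which commutes with all of Bob's operators and can be pulled out in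
      -- front, and in the other term it is exchanged back (error δ). What remains is the hypothesis
      -- for ψ.
      have e : (fun t => seqProj b t (b j.succ ψ) - (-1 : ℂ) ^ (t j.succ : ℕ) • seqProj b t ψ) =
          fun t => (F t (signProj (b 0) (t 0) (b j.succ ψ) - b j.succ (signProj (b 0) (t 0) ψ)) +
            F t (b j.succ (signProj (b 0) (t 0) ψ - signProj (c 0) (t 0) ψ))) +
            ((-1 : ℂ) ^ (t j.succ : ℕ) • F t (signProj (c 0) (t 0) ψ - signProj (b 0) (t 0) ψ) +
            signProj (c 0) (t 0) (F t (b j.succ ψ) - (-1 : ℂ) ^ (t j.succ : ℕ) • F t ψ)) := by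
        funext t
        have h1 : Commute (signProj (c 0) (t 0)) (F t) :=
          (Commute.seqProj_right (fun i => ((hbc i.succ 0).signProj_right _).symm) _)
        have h2 : Commute (signProj (c 0) (t 0)) (b j.succ) := ((hbc j.succ 0).signProj_right _).symm
        simp only [map_sub, map_smul, seqProj, mul_apply_eq_comp]
        rw [commute_apply h1, commute_apply h1, commute_apply h2, smul_sub]
        simp only [hF]
        abel
      rw [e]
      refine (l2norm_add_le _ _).trans ((add_le_add (l2norm_add_le _ _) (l2norm_add_le _ _)).trans ?_)
      have b1 := l2norm_signProj_commutator_le hδ' (hcomm 0 j.succ)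
      have b2 := l2norm_signProj_sub_le hδ (hψ 0)
      have b3 : l2norm (fun t : Fin (m + 1) → Fin 2 =>
          F t (b j.succ (signProj (b 0) (t 0) ψ - signProj (c 0) (t 0) ψ))) ≤ δ := by
        rw [key fun s => b j.succ (signProj (b 0) s ψ - signProj (c 0) s ψ)]
        exact (l2norm_mono fun s => ((hb j.succ).norm_apply _).le).trans b2
      have b4 : l2norm (fun t : Fin (m + 1) → Fin 2 => (-1 : ℂ) ^ (t j.succ : ℕ) •
          F t (signProj (c 0) (t 0) ψ - signProj (b 0) (t 0) ψ)) ≤ δ := by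
        refine (l2norm_mono fun t => (norm_neg_one_pow_smul _ _).le).trans ?_
        rw [key fun s => signProj (c 0) s ψ - signProj (b 0) s ψ, l2norm_sub_comm]
        exact b2
      -- Charlie's projector is now outermost, and summing over its outcome removes it.
      have b5 : l2norm (fun t : Fin (m + 1) → Fin 2 =>
          signProj (c 0) (t 0) (F t (b j.succ ψ) - (-1 : ℂ) ^ (t j.succ : ℕ) • F t ψ)) ≤
          m * (δ' + 2 * δ) := by
        refine le_trans (le_of_eq ?_) ih'
        refine (sq_eq_sq₀ (l2norm_nonneg _) (l2norm_nonneg _)).mp ?_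
        rw [l2norm_sq, l2norm_sq, sum_fin_succ_arrow, Finset.sum_comm]
        simp only [hF, Fin.tail_cons, Fin.cons_zero, Fin.cons_succ, sum_norm_signProj (hc 0)]
        rfl
      rw [key fun s => signProj (b 0) s (b j.succ ψ) - b j.succ (signProj (b 0) s ψ)]
      push_cast
      linarith

end SequentialProjections

/-! ### The dilated state and its approximate invariance under projections -/

section Dilation

/-- The combination `((-1)^s P + (-1)^{s'} Q)/√2` of two operators. -/
def mixedObs {𝓐 : Type*} [Ring 𝓐] [Algebra ℂ 𝓐] (P Q : 𝓐) (s s' : Fin 2) : 𝓐 :=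
  (((√2 : ℝ) : ℂ)⁻¹) • ((-1 : ℂ) ^ (s : ℕ) • P + (-1 : ℂ) ^ (s' : ℕ) • Q)

theorem map_mixedObs {𝓐 𝓑 F : Type*} [Ring 𝓐] [Algebra ℂ 𝓐] [Ring 𝓑] [Algebra ℂ 𝓑]
    [FunLike F 𝓐 𝓑] [AlgHomClass F ℂ 𝓐 𝓑] (f : F) (P Q : 𝓐) (s s' : Fin 2) :
    f (mixedObs P Q s s') = mixedObs (f P) (f Q) s s' := by
  simp [mixedObs]

/-- A union bound: equality of strings is imposed coordinate by coordinate, and each restriction is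
a contraction, so the errors add. -/
theorem l2norm_sub_ite_eq_le {κ Y ι H : Type*} [NormedAddCommGroup H] [Fintype κ] [DecidableEq Y] [Fintype ι]
    (χ : ι → H) (s s' : ι → κ → Y) [∀ i, Decidable (s i = s' i)] :
    l2norm (fun i => χ i - if s i = s' i then χ i else 0) ≤
      ∑ k, l2norm fun i => χ i - if s i k = s' i k then χ i else 0 := by
  classical
  have h : ∀ S : Finset κ, l2norm (fun i => χ i - if ∀ k ∈ S, s i k = s' i k then χ i else 0) ≤
      ∑ k ∈ S, l2norm fun i => χ i - if s i k = s' i k then χ i else 0 := fun S => by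
    induction S using Finset.induction with
    | empty => exact l2norm_le_of_sum_le (by simp) (by simp)
    | insert k S hk ih =>
      rw [Finset.sum_insert hk]
      refine (l2norm_sub_le_add χ (fun i => if s i k = s' i k then χ i else 0) _).trans
        (add_le_add_right (le_trans (l2norm_mono fun i => ?_) ih) _)
      by_cases h1 : s i k = s' i k <;> simp [h1]
  simpa [funext_iff] using h Finset.univ

variable {H : Type*} [NormedAddCommGroup H] [InnerProductSpace ℂ H]

theorem mixedObs_apply (P Q : H →L[ℂ] H) (s s' : Fin 2) (x : H) :
    mixedObs P Q s s' x =
      (((√2 : ℝ) : ℂ)⁻¹) • ((-1 : ℂ) ^ (s : ℕ) • P x + (-1 : ℂ) ^ (s' : ℕ) • Q x) := by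
  simp [mixedObs]

/-- From χ - MNχ = (χ - Mχ) + M(χ - Nχ) with M a contraction. The factors need not commute. -/
theorem l2norm_sub_list_prod_le {ι : Type*} [Fintype ι] (χ : ι → H)
    (l : List (ι → H →L[ℂ] H)) (hl : ∀ M ∈ l, ∀ i x, ‖M i x‖ ≤ ‖x‖) :
    l2norm (fun i => χ i - (l.map fun M => M i).prod (χ i)) ≤
      (l.map fun M => l2norm fun i => χ i - M i (χ i)).sum := by
  induction l with
  | nil => exact l2norm_le_of_sum_le (by simp) (by simp)
  | cons M l ih =>
    have ih' := ih fun N hN => hl N (List.mem_cons_of_mem _ hN)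
    simp only [List.map_cons, List.prod_cons, List.sum_cons,
      mul_apply_eq_comp]
    refine (l2norm_sub_le_add χ (fun i => M i (χ i)) _).trans (add_le_add_right ?_ _)
    refine le_trans (l2norm_mono fun i => ?_) ih'
    rw [← map_sub]
    exact hl M List.mem_cons_self i _

variable [CompleteSpace H]

/-- The two summands are orthogonal by anticommutation. This makes the qubit projectors
contractions. -/
theorem norm_mixedObs {P Q : H →L[ℂ] H} (hP : IsReflection P) (hQ : IsReflection Q)
    (h : P * Q = -(Q * P)) (s s' : Fin 2) (x : H) : ‖mixedObs P Q s s' x‖ = ‖x‖ := by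
  have h0 := reInner_eq_zero_of_anticommute hP hQ h x
  have h1 : ‖(-1 : ℂ) ^ (s : ℕ) • P x + (-1 : ℂ) ^ (s' : ℕ) • Q x‖ ^ 2 = 2 * ‖x‖ ^ 2 := by
    have hs : ∀ s : Fin 2, (-1 : ℂ) ^ (s : ℕ) = (((-1 : ℝ) ^ (s : ℕ) : ℝ) : ℂ) := by simp
    rw [norm_add_sq_reInner, norm_neg_one_pow_smul, norm_neg_one_pow_smul, hs, hs,
      reInner_smul_left, reInner_smul_right, h0, hP.norm_apply, hQ.norm_apply]
    ring
  refine (sq_eq_sq₀ (norm_nonneg _) (norm_nonneg _)).mp ?_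
  rw [mixedObs_apply, norm_smul, mul_pow, h1, norm_inv, Complex.norm_real, Real.norm_eq_abs,
    inv_pow, sq_abs, Real.sq_sqrt (by norm_num)]
  ring

/-- The family of vectors of the sequential measurements of both players. -/
def dilate {m : ℕ} (b c : Fin m → H →L[ℂ] H) (x : H) (p : (Fin m → Fin 2) × (Fin m → Fin 2)) : H :=
  seqProj b p.1 (seqProj c p.2 x)

variable {m : ℕ} {b c : Fin m → H →L[ℂ] H}

omit [CompleteSpace H] in
theorem dilate_comm (hbc : ∀ j k, Commute (b j) (c k)) (x : H)
    (p : (Fin m → Fin 2) × (Fin m → Fin 2)) : dilate b c x p = dilate c b x p.swap :=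
  commute_apply (Commute.seqProj_right
    (fun k => (Commute.seqProj_right (fun j => (hbc j k).symm) _).symm) _) x

theorem l2norm_dilate (hb : ∀ k, IsReflection (b k)) (hc : ∀ k, IsReflection (c k)) (x : H) :
    l2norm (dilate b c x) = ‖x‖ := by
  refine (sq_eq_sq₀ (l2norm_nonneg _) (norm_nonneg _)).mp ?_
  rw [l2norm_sq, Fintype.sum_prod_type_right]
  simp only [dilate, sum_norm_seqProj hb, sum_norm_seqProj hc]

/-- Bob's measurement is the outer one and preserves the total norm, so estimates for Charlie's
measurement alone transfer to the dilated state. -/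
theorem l2norm_dilate_sub_right (hb : ∀ k, IsReflection (b k)) (x y : H) (k : Fin m) :
    l2norm (fun p => dilate b c x p - (-1 : ℂ) ^ (p.2 k : ℕ) • dilate b c y p) =
      l2norm fun t => seqProj c t x - (-1 : ℂ) ^ (t k : ℕ) • seqProj c t y := by
  refine (sq_eq_sq₀ (l2norm_nonneg _) (l2norm_nonneg _)).mp ?_
  rw [l2norm_sq, l2norm_sq, Fintype.sum_prod_type_right]
  simp only [dilate, ← map_smul, ← map_sub, sum_norm_seqProj hb]

theorem l2norm_dilate_sub_left (hc : ∀ k, IsReflection (c k))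
    (hbc : ∀ j k, Commute (b j) (c k)) (x y : H) (k : Fin m) :
    l2norm (fun p => dilate b c x p - (-1 : ℂ) ^ (p.1 k : ℕ) • dilate b c y p) =
      l2norm fun t => seqProj b t x - (-1 : ℂ) ^ (t k : ℕ) • seqProj b t y := by
  rw [← l2norm_dilate_sub_right hc]
  refine (sq_eq_sq₀ (l2norm_nonneg _) (l2norm_nonneg _)).mp ?_
  rw [l2norm_sq, l2norm_sq, ← (Equiv.prodComm _ _).sum_comp]
  simp only [dilate_comm hbc, Equiv.prodComm_apply, Prod.swap_swap, Prod.fst_swap]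

/-- Where the records differ, the two recorded signs are opposite, so that part of the state is, up
to sign, half the difference of the signed states. These are `r`-close to the dilations of `b k ψ`
and `c k ψ`, which are `δ`-close to each other. -/
theorem l2norm_dilate_register_le (hb : ∀ k, IsReflection (b k)) (hc : ∀ k, IsReflection (c k))
    (hbc : ∀ j k, Commute (b j) (c k)) {ψ : H} {δ r : ℝ} (k : Fin m) (hψ : ‖b k ψ - c k ψ‖ ≤ δ)
    (hbr : l2norm (fun t => seqProj b t (b k ψ) - (-1 : ℂ) ^ (t k : ℕ) • seqProj b t ψ) ≤ r)
    (hcr : l2norm (fun t => seqProj c t (c k ψ) - (-1 : ℂ) ^ (t k : ℕ) • seqProj c t ψ) ≤ r) :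
    l2norm (fun p => dilate b c ψ p - if p.1 k = p.2 k then dilate b c ψ p else 0) ≤
      (1 / 2) * (2 * r + δ) := by
  rw [← l2norm_dilate_sub_left hc hbc] at hbr
  rw [← l2norm_dilate_sub_right hb] at hcr
  have e : (fun p => dilate b c ψ p - if p.1 k = p.2 k then dilate b c ψ p else 0) =
      fun p => (1 / 2 : ℂ) • (-1 : ℂ) ^ (p.1 k : ℕ) • ((-1 : ℂ) ^ (p.1 k : ℕ) • dilate b c ψ p -
        (-1 : ℂ) ^ (p.2 k : ℕ) • dilate b c ψ p) := by
    funext p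
    generalize p.1 k = s
    generalize p.2 k = s'
    fin_cases s <;> fin_cases s' <;> simp <;> module
  have h1 : l2norm (fun p => dilate b c (b k ψ) p - dilate b c (c k ψ) p) ≤ δ := by
    refine le_trans (le_of_eq ?_) hψ
    rw [← l2norm_dilate hb hc]
    exact congrArg l2norm (funext fun p => by simp only [dilate, map_sub])
  rw [e, l2norm_smul]
  norm_num
  refine (l2norm_mono fun p => (norm_neg_one_pow_smul _ _).le).trans ?_
  refine (l2norm_sub_le_add _ (dilate b c (b k ψ)) _).trans ?_
  rw [l2norm_sub_comm]
  have h2 := l2norm_sub_le_add (dilate b c (b k ψ)) (dilate b c (c k ψ))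
    (fun p => (-1 : ℂ) ^ (p.2 k : ℕ) • dilate b c ψ p)
  linarith

/-- The complementary projector is (1 - M)/2 for the signed combination M. Multiplied by √2, the
vector (1 - M)χ is the dilation of the defect of ψ plus two errors from replacing an observable by
its recorded sign. -/
theorem l2norm_dilate_qubit_le (hb : ∀ k, IsReflection (b k)) (hc : ∀ k, IsReflection (c k))
    (hbc : ∀ j k, Commute (b j) (c k)) {P Q : H →L[ℂ] H} (hP : IsReflection P)
    (hQ : IsReflection Q) (hPb : ∀ k, Commute P (b k)) (hPc : ∀ k, Commute P (c k))
    (hQb : ∀ k, Commute Q (b k)) (hQc : ∀ k, Commute Q (c k)) {ψ : H} {δ r : ℝ} (k l : Fin m)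
    (hψ : ‖((√2 : ℝ) : ℂ) • ψ - (P (b k ψ) + Q (b l ψ))‖ ≤ δ)
    (hbr : ∀ k, l2norm (fun t => seqProj b t (b k ψ) - (-1 : ℂ) ^ (t k : ℕ) • seqProj b t ψ) ≤ r) :
    l2norm (fun p => dilate b c ψ p -
      signProj (mixedObs P Q (p.1 k) (p.1 l)) 0 (dilate b c ψ p)) ≤ (1 / 2) * (δ + 2 * r) := by
  have hPd : ∀ x p, dilate b c (P x) p = P (dilate b c x p) := fun x p => by
    rw [dilate, dilate, ← commute_apply (Commute.seqProj_right hPc _),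
      ← commute_apply (Commute.seqProj_right hPb _)]
  have hQd : ∀ x p, dilate b c (Q x) p = Q (dilate b c x p) := fun x p => by
    rw [dilate, dilate, ← commute_apply (Commute.seqProj_right hQc _),
      ← commute_apply (Commute.seqProj_right hQb _)]
  have hs : ((√2 : ℝ) : ℂ)⁻¹ * ((√2 : ℝ) : ℂ) = 1 := inv_mul_cancel₀ (by simp)
  have e : (fun p => dilate b c ψ p -
      signProj (mixedObs P Q (p.1 k) (p.1 l)) 0 (dilate b c ψ p)) =
      fun p => ((1 / 2 : ℂ) * ((√2 : ℝ) : ℂ)⁻¹) •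
        (dilate b c (((√2 : ℝ) : ℂ) • ψ - (P (b k ψ) + Q (b l ψ))) p +
        (P (dilate b c (b k ψ) p - (-1 : ℂ) ^ (p.1 k : ℕ) • dilate b c ψ p) +
        Q (dilate b c (b l ψ) p - (-1 : ℂ) ^ (p.1 l : ℕ) • dilate b c ψ p))) := by
    funext p
    have e1 : dilate b c (((√2 : ℝ) : ℂ) • ψ - (P (b k ψ) + Q (b l ψ))) p =
        ((√2 : ℝ) : ℂ) • dilate b c ψ p - (P (dilate b c (b k ψ) p) + Q (dilate b c (b l ψ) p)) := by
      rw [← hPd, ← hQd]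
      simp only [dilate, map_sub, map_add, map_smul]
    have e2 : dilate b c ψ p = (((√2 : ℝ) : ℂ)⁻¹ * ((√2 : ℝ) : ℂ)) • dilate b c ψ p := by
      rw [hs, one_smul]
    rw [e1, signProj_apply, mixedObs_apply]
    simp only [map_sub, map_smul, Fin.val_zero, pow_zero]
    nth_rw 1 2 [e2]
    module
  rw [e, l2norm_smul]
  have h1 : ‖(1 / 2 : ℂ) * ((√2 : ℝ) : ℂ)⁻¹‖ ≤ 1 / 2 := by
    rw [norm_mul, norm_inv, Complex.norm_real, Real.norm_eq_abs, abs_of_nonneg (Real.sqrt_nonneg _)]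
    have : (√2)⁻¹ ≤ 1 := inv_le_one_of_one_le₀ (Real.one_le_sqrt.mpr (by norm_num))
    norm_num
    linarith
  refine mul_le_mul h1 ?_ (l2norm_nonneg _) (by norm_num)
  refine (l2norm_add_le _ _).trans ?_
  refine (add_le_add_right (l2norm_add_le _ _) _).trans ?_
  have h2 : l2norm (fun p => dilate b c (((√2 : ℝ) : ℂ) • ψ - (P (b k ψ) + Q (b l ψ))) p) ≤ δ :=
    (l2norm_dilate hb hc _).le.trans hψ
  have h3 := (l2norm_dilate_sub_left hc hbc (b k ψ) ψ k).le.trans (hbr k)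
  have h4 := (l2norm_dilate_sub_left hc hbc (b l ψ) ψ l).le.trans (hbr l)
  have h5 := (l2norm_mono fun p => (hP.norm_apply
    (dilate b c (b k ψ) p - (-1 : ℂ) ^ (p.1 k : ℕ) • dilate b c ψ p)).le).trans h3
  have h6 := (l2norm_mono fun p => (hQ.norm_apply
    (dilate b c (b l ψ) p - (-1 : ℂ) ^ (p.1 l : ℕ) • dilate b c ψ p)).le).trans h4
  linarith

end Dilation

/-! ### All rounds together -/

section Rigidity

variable {H : Type*} [NormedAddCommGroup H] [InnerProductSpace ℂ H] [CompleteSpace H]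

/-- The position of the pair `(i, θ)` among the observables of a player. -/
def obsIndex {n : ℕ} (i : Fin n) (θ : Fin 2) : Fin (n * 2) := finProdFinEquiv (i, θ)

/-- The observables of a player in a single sequence. -/
def obsSeq {𝓐 : Type*} {n : ℕ} (b : Fin n → Fin 2 → 𝓐) (k : Fin (n * 2)) : 𝓐 :=
  b (finProdFinEquiv.symm k).1 (finProdFinEquiv.symm k).2

theorem obsSeq_obsIndex {𝓐 : Type*} {n : ℕ} (b : Fin n → Fin 2 → 𝓐) (i : Fin n) (θ : Fin 2) :
    obsSeq b (obsIndex i θ) = b i θ := by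
  simp [obsSeq, obsIndex]

variable {n : ℕ} {a b c : Fin n → Fin 2 → H →L[ℂ] H} {ψ : H} {ε : ℝ}

/-- Round `i` supplies the eigenvalue relation, and round `j` supplies the pair of agreeing
observables. The case `i = j` is included: Bob's two observables of one round also almost commute on
the state. -/
theorem norm_commutator_rounds_le
    (h : ∀ i, IsRound (a i 0) (a i 1) (b i 0) (b i 1) (c i 0) (c i 1) ψ ε)
    (hab : ∀ i θ j θ', Commute (a i θ) (b j θ')) (hac : ∀ i θ j θ', Commute (a i θ) (c j θ'))
    (hbc : ∀ i θ j θ', Commute (b i θ) (c j θ')) (i : Fin n) (θ : Fin 2) (j : Fin n)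
    (θ' : Fin 2) : ‖b i θ (b j θ' ψ) - b j θ' (b i θ ψ)‖ ≤ 25 * √ε := by
  have hb : IsReflection (b j θ') := by
    fin_cases θ'
    exacts [(h j).hB₀, (h j).hB₁]
  have hc : IsReflection (c j θ') := by
    fin_cases θ'
    exacts [(h j).hC₀, (h j).hC₁]
  have hd : ‖b j θ' ψ - c j θ' ψ‖ ≤ 4 * √ε := by
    fin_cases θ'
    exacts [(h j).norm_players_le, (h j).swap_questions.norm_players_le]
  fin_cases θ
  · exact (h i).norm_commutator_le hb hc (hab _ _ _ _) (hab _ _ _ _) (hbc _ _ _ _) (hbc _ _ _ _)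
      (hac _ _ _ _) (hac _ _ _ _) (hbc _ _ _ _) (hbc _ _ _ _) hd
  · exact (h i).swap_questions.norm_commutator_le hb hc (hab _ _ _ _) (hab _ _ _ _) (hbc _ _ _ _)
      (hbc _ _ _ _) (hac _ _ _ _) (hac _ _ _ _) (hbc _ _ _ _) (hbc _ _ _ _) hd

theorem norm_players_rounds_le
    (h : ∀ i, IsRound (a i 0) (a i 1) (b i 0) (b i 1) (c i 0) (c i 1) ψ ε) (i : Fin n)
    (θ : Fin 2) : ‖b i θ ψ - c i θ ψ‖ ≤ 4 * √ε := by
  fin_cases θ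
  exacts [(h i).norm_players_le, (h i).swap_questions.norm_players_le]

theorem isReflection_bob_rounds
    (h : ∀ i, IsRound (a i 0) (a i 1) (b i 0) (b i 1) (c i 0) (c i 1) ψ ε) (i : Fin n)
    (θ : Fin 2) : IsReflection (b i θ) := by
  fin_cases θ
  exacts [(h i).hB₀, (h i).hB₁]

theorem l2norm_obsSeq_le
    (h : ∀ i, IsRound (a i 0) (a i 1) (b i 0) (b i 1) (c i 0) (c i 1) ψ ε)
    (hab : ∀ i θ j θ', Commute (a i θ) (b j θ')) (hac : ∀ i θ j θ', Commute (a i θ) (c j θ'))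
    (hbc : ∀ i θ j θ', Commute (b i θ) (c j θ')) (k : Fin (n * 2)) :
    l2norm (fun t => seqProj (obsSeq b) t (obsSeq b k ψ) -
      (-1 : ℂ) ^ (t k : ℕ) • seqProj (obsSeq b) t ψ) ≤ 66 * n * √ε := by
  -- With 2n reflections the bound is 2n(25 + 2 · 4)√ε = 66n√ε.
  refine (l2norm_seqProj_apply_sub_le (c := obsSeq c) (δ := 4 * √ε) (δ' := 25 * √ε)
    (fun _ => isReflection_bob_rounds h _ _)
    (fun _ => isReflection_bob_rounds (fun i => (h i).swap_players) _ _) (fun _ _ => hbc _ _ _ _)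
    (by positivity) (by positivity) (fun _ => norm_players_rounds_le h _ _)
    (fun _ _ => norm_commutator_rounds_le h hab hac hbc _ _ _ _) k).trans (le_of_eq ?_)
  push_cast
  ring

/-- The dilated state is close to its projection onto the span of the states in which both
registers hold the same string `t` and the qubits are in the states given by `t`. -/
theorem l2norm_dilate_sub_project_le (hn : 1 ≤ n)
    (h : ∀ i, IsRound (a i 0) (a i 1) (b i 0) (b i 1) (c i 0) (c i 1) ψ ε)
    (hab : ∀ i θ j θ', Commute (a i θ) (b j θ')) (hac : ∀ i θ j θ', Commute (a i θ) (c j θ'))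
    (hbc : ∀ i θ j θ', Commute (b i θ) (c j θ')) :
    l2norm (fun p => dilate (obsSeq b) (obsSeq c) ψ p - if p.1 = p.2 then
      (List.ofFn fun i => signProj (mixedObs (a i 0) (a i 1) (p.1 (obsIndex i 0))
        (p.1 (obsIndex i 1))) 0).prod (dilate (obsSeq b) (obsSeq c) ψ p) else 0) ≤
      207 * n ^ 2 * √ε := by
  have hb : ∀ k, IsReflection (obsSeq b k) := fun _ => isReflection_bob_rounds h _ _
  have hc : ∀ k, IsReflection (obsSeq c k) := fun _ =>
    isReflection_bob_rounds (fun i => (h i).swap_players) _ _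
  have hbc' : ∀ j k, Commute (obsSeq b j) (obsSeq c k) := fun _ _ => hbc _ _ _ _
  have hbr := l2norm_obsSeq_le h hab hac hbc
  have hcr := l2norm_obsSeq_le (fun i => (h i).swap_players) hac hab
    (fun i θ j θ' => (hbc j θ' i θ).symm)
  set χ := dilate (obsSeq b) (obsSeq c) ψ with hχ
  set q := fun (i : Fin n) (p : (Fin (n * 2) → Fin 2) × (Fin (n * 2) → Fin 2)) =>
    signProj (mixedObs (a i 0) (a i 1) (p.1 (obsIndex i 0)) (p.1 (obsIndex i 1))) 0 with hq
  have h1 : l2norm (fun p => χ p - if p.1 = p.2 then χ p else 0) ≤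
      ∑ _k : Fin (n * 2), (1 / 2) * (2 * (66 * n * √ε) + 4 * √ε) :=
    (l2norm_sub_ite_eq_le χ Prod.fst Prod.snd).trans (Finset.sum_le_sum fun k _ =>
      l2norm_dilate_register_le hb hc hbc' k (norm_players_rounds_le h _ _) (hbr k) (hcr k))
  have h2 : l2norm (fun p => χ p - (List.ofFn fun i => q i p).prod (χ p)) ≤
      ∑ _i : Fin n, (1 / 2) * (9 * √ε + 2 * (66 * n * √ε)) := by
    have h3 := l2norm_sub_list_prod_le χ (List.ofFn q) (by
      intro M hM p x
      obtain ⟨i, rfl⟩ := (List.mem_ofFn' _ _).mp hM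
      rw [hq, signProj_apply, norm_smul]
      have h4 := norm_add_le x (mixedObs (a i 0) (a i 1) (p.1 (obsIndex i 0))
        (p.1 (obsIndex i 1)) x)
      rw [norm_mixedObs (h i).hZ (h i).hX (h i).anti] at h4
      norm_num
      linarith)
    simp only [List.map_ofFn, List.sum_ofFn] at h3
    refine h3.trans (Finset.sum_le_sum fun i _ => ?_)
    refine l2norm_dilate_qubit_le hb hc hbc' (h i).hZ (h i).hX (fun _ => hab _ _ _ _)
      (fun _ => hac _ _ _ _) (fun _ => hab _ _ _ _) (fun _ => hac _ _ _ _) _ _ ?_ hbr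
    rw [obsSeq_obsIndex, obsSeq_obsIndex]
    exact (h i).norm_bob_le
  refine (l2norm_sub_le_add χ (fun p => if p.1 = p.2 then χ p else 0) _).trans ?_
  have h5 : l2norm (fun p => (if p.1 = p.2 then χ p else 0) -
      if p.1 = p.2 then (List.ofFn fun i => q i p).prod (χ p) else 0) ≤
      l2norm (fun p => χ p - (List.ofFn fun i => q i p).prod (χ p)) :=
    l2norm_mono fun p => by
      by_cases hp : p.1 = p.2 <;> simp [hp]
  refine (add_le_add h1 (h5.trans h2)).trans ?_
  -- The 2n registers contribute 132n² + 4n and the n qubits 66n² + 4.5n, together at most 206.5n²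
  -- since n ≥ 1.
  simp only [Finset.sum_const, Finset.card_univ, Fintype.card_fin, nsmul_eq_mul]
  push_cast
  have hn' : (1 : ℝ) ≤ n := by exact_mod_cast hn
  have h6 : (n : ℝ) * √ε ≤ n ^ 2 * √ε :=
    mul_le_mul_of_nonneg_right (by nlinarith) (Real.sqrt_nonneg _)
  nlinarith [Real.sqrt_nonneg ε]

end Rigidity

/-! ### Operators on single tensor factors -/

section RegisterOperators

/-- The extension of operators to a further register on the right, by the identity. -/
def kronLeftHom (H K : Type*) [Fintype H] [DecidableEq H] [Fintype K] [DecidableEq K] :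
    Matrix H H ℂ →⋆ₐ[ℂ] Matrix (H × K) (H × K) ℂ where
  toFun M := M ⊗ₖ (1 : Matrix K K ℂ)
  map_one' := Matrix.one_kronecker_one
  map_mul' M N := by rw [← Matrix.mul_kronecker_mul, one_mul]
  map_zero' := Matrix.zero_kronecker _
  map_add' M N := Matrix.add_kronecker _ _ _
  commutes' r := by
    rw [Algebra.algebraMap_eq_smul_one, Algebra.algebraMap_eq_smul_one, Matrix.smul_kronecker,
      Matrix.one_kronecker_one]
  map_star' M := by
    rw [Matrix.star_eq_conjTranspose, Matrix.star_eq_conjTranspose, Matrix.conjTranspose_kronecker,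
      Matrix.conjTranspose_one]

/-- The extension of operators to a further register on the left, by the identity. -/
def kronRightHom (K H : Type*) [Fintype H] [DecidableEq H] [Fintype K] [DecidableEq K] :
    Matrix H H ℂ →⋆ₐ[ℂ] Matrix (K × H) (K × H) ℂ where
  toFun M := (1 : Matrix K K ℂ) ⊗ₖ M
  map_one' := Matrix.one_kronecker_one
  map_mul' M N := by rw [← Matrix.mul_kronecker_mul, one_mul]
  map_zero' := Matrix.kronecker_zero _
  map_add' M N := Matrix.kronecker_add _ _ _
  commutes' r := by
    rw [Algebra.algebraMap_eq_smul_one, Algebra.algebraMap_eq_smul_one, Matrix.kronecker_smul,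
      Matrix.one_kronecker_one]
  map_star' M := by
    rw [Matrix.star_eq_conjTranspose, Matrix.star_eq_conjTranspose, Matrix.conjTranspose_kronecker,
      Matrix.conjTranspose_one]

theorem commute_kronLeftHom_kronRightHom {H K : Type*} [Fintype H] [DecidableEq H] [Fintype K]
    [DecidableEq K] (M : Matrix H H ℂ) (N : Matrix K K ℂ) :
    Commute (kronLeftHom H K M) (kronRightHom H K N) := by
  change (M ⊗ₖ (1 : Matrix K K ℂ)) * ((1 : Matrix H H ℂ) ⊗ₖ N) =
    ((1 : Matrix H H ℂ) ⊗ₖ N) * (M ⊗ₖ (1 : Matrix K K ℂ))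
  rw [← Matrix.mul_kronecker_mul, ← Matrix.mul_kronecker_mul]
  simp

/-- Matrices as operators on the Hilbert space of a register. -/
def clmHom (H : Type*) [Fintype H] [DecidableEq H] :
    Matrix H H ℂ →⋆ₐ[ℂ] (EuclideanSpace ℂ H →L[ℂ] EuclideanSpace ℂ H) :=
  (Matrix.toEuclideanCLM (𝕜 := ℂ) (n := H) : Matrix H H ℂ →⋆ₐ[ℂ] _)

variable (A B C R : Type*) [Fintype A] [DecidableEq A] [Fintype B] [DecidableEq B] [Fintype C]
  [DecidableEq C] [Fintype R] [DecidableEq R]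

/-- Operators on the first of four registers. -/
def aliceHom : Matrix A A ℂ →⋆ₐ[ℂ]
    (EuclideanSpace ℂ (A × B × C × R) →L[ℂ] EuclideanSpace ℂ (A × B × C × R)) :=
  (clmHom _).comp (kronLeftHom A (B × C × R))

/-- Operators on the second of four registers. -/
def bobHom : Matrix B B ℂ →⋆ₐ[ℂ]
    (EuclideanSpace ℂ (A × B × C × R) →L[ℂ] EuclideanSpace ℂ (A × B × C × R)) :=
  (clmHom _).comp ((kronRightHom A (B × C × R)).comp (kronLeftHom B (C × R)))

/-- Operators on the third of four registers. -/
def charlieHom : Matrix C C ℂ →⋆ₐ[ℂ]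
    (EuclideanSpace ℂ (A × B × C × R) →L[ℂ] EuclideanSpace ℂ (A × B × C × R)) :=
  (clmHom _).comp
    ((kronRightHom A (B × C × R)).comp ((kronRightHom B (C × R)).comp (kronLeftHom C R)))

theorem commute_aliceHom_bobHom (M : Matrix A A ℂ) (N : Matrix B B ℂ) :
    Commute (aliceHom A B C R M) (bobHom A B C R N) :=
  (commute_kronLeftHom_kronRightHom M _).map (clmHom _)

theorem commute_aliceHom_charlieHom (M : Matrix A A ℂ) (N : Matrix C C ℂ) :
    Commute (aliceHom A B C R M) (charlieHom A B C R N) :=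
  (commute_kronLeftHom_kronRightHom M _).map (clmHom _)

theorem commute_bobHom_charlieHom (M : Matrix B B ℂ) (N : Matrix C C ℂ) :
    Commute (bobHom A B C R M) (charlieHom A B C R N) :=
  ((commute_kronLeftHom_kronRightHom M _).map (kronRightHom A _)).map (clmHom _)

theorem bobHom_mul_charlieHom (M : Matrix B B ℂ) (N : Matrix C C ℂ) :
    bobHom A B C R M * charlieHom A B C R N =
      clmHom _ ((1 : Matrix A A ℂ) ⊗ₖ (M ⊗ₖ (N ⊗ₖ (1 : Matrix R R ℂ)))) := by
  simp only [bobHom, charlieHom, StarAlgHom.comp_apply, ← map_mul]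
  refine congrArg (clmHom _) (congrArg (fun K => (1 : Matrix A A ℂ) ⊗ₖ K) ?_)
  change (M ⊗ₖ (1 : Matrix (C × R) (C × R) ℂ)) *
    ((1 : Matrix B B ℂ) ⊗ₖ (N ⊗ₖ (1 : Matrix R R ℂ))) = _
  rw [← Matrix.mul_kronecker_mul, one_mul, mul_one]

theorem aliceHom_mul_bobHom_mul_charlieHom (L : Matrix A A ℂ) (M : Matrix B B ℂ)
    (N : Matrix C C ℂ) : aliceHom A B C R L * (bobHom A B C R M * charlieHom A B C R N) =
      clmHom _ (L ⊗ₖ (M ⊗ₖ (N ⊗ₖ (1 : Matrix R R ℂ)))) := by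
  rw [bobHom_mul_charlieHom, aliceHom, StarAlgHom.comp_apply, ← map_mul]
  congr 1
  change (L ⊗ₖ (1 : Matrix (B × C × R) (B × C × R) ℂ)) * _ = _
  rw [← Matrix.mul_kronecker_mul, one_mul, mul_one]

variable {A B C R}

theorem isReflection_map {H : Type*} [NormedAddCommGroup H] [InnerProductSpace ℂ H]
    [CompleteSpace H] {X : Type*} [Fintype X] [DecidableEq X]
    (f : Matrix X X ℂ →⋆ₐ[ℂ] (H →L[ℂ] H)) {M : Matrix X X ℂ} (hM : M.IsHermitian)
    (h : M * M = 1) : IsReflection (f M) where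
  isSelfAdjoint := IsSelfAdjoint.map hM.isSelfAdjoint f
  mul_self := by rw [← map_mul, h, map_one]

theorem trace_mul_ketbra_re {H : Type*} [Fintype H] [DecidableEq H] (M : Matrix H H ℂ)
    (x : EuclideanSpace ℂ H) : (Matrix.trace (M * ketbra x)).re = reInner x (clmHom H M x) := by
  rw [ketbra, Matrix.mul_vecMulVec, Matrix.trace_vecMulVec, reInner,
    EuclideanSpace.inner_eq_star_dotProduct]
  rfl

end RegisterOperators

/-! ### Measurements and their observables -/

section ProjectiveMeasurements

theorem POVM.op_eq_signProj {H : Type*} [Fintype H] [DecidableEq H] (P : POVM (Fin 2) H)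
    (y : Fin 2) : P.op y = signProj P.observable y := by
  have h := P.sum_eq_one
  rw [Fin.sum_univ_two] at h
  rw [signProj, POVM.observable, ← h]
  fin_cases y
  · simp only [Fin.zero_eta, pow_zero]
    module
  · simp only [Fin.mk_one, pow_one]
    module

theorem POVM.isHermitian_observable {H : Type*} [Fintype H] [DecidableEq H]
    (P : POVM (Fin 2) H) : P.observable.IsHermitian :=
  (P.posSemidef 0).isHermitian.sub (P.posSemidef 1).isHermitian

theorem POVM.IsProjective.marginal_mul_self {n : ℕ} {Y H : Type*} [Fintype Y] [DecidableEq Y]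
    [Fintype H] [DecidableEq H] {P : POVM (Fin n → Y) H} (hP : P.IsProjective) (i : Fin n)
    (y : Y) : (P.marginal i).op y * (P.marginal i).op y = (P.marginal i).op y := by
  simp only [POVM.marginal, Finset.sum_mul, Finset.mul_sum]
  refine Finset.sum_congr rfl fun x hx => ?_
  simp only [hP _ _]
  rw [Finset.sum_ite_eq', if_pos hx]

theorem POVM.IsProjective.observable_mul_self {n : ℕ} {H : Type*} [Fintype H] [DecidableEq H]
    {P : POVM (Fin n → Fin 2) H} (hP : P.IsProjective) (i : Fin n) :
    (P.marginal i).observable * (P.marginal i).observable = 1 := by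
  have h0 := hP.marginal_mul_self i 0
  have h := (P.marginal i).sum_eq_one
  rw [Fin.sum_univ_two, ← eq_sub_iff_add_eq'] at h
  rw [POVM.observable, h]
  have h1 : ∀ p : Matrix H H ℂ, p * p = p → (p - (1 - p)) * (p - (1 - p)) = 1 := fun p hp => by
    have : (p - (1 - p)) * (p - (1 - p)) = 4 • (p * p) - 4 • p + 1 := by noncomm_ring
    rw [this, hp, sub_self, zero_add]
  exact h1 _ h0

/-- The terms of odd degree cancel between the two signs. Hence the probability that three answers
coincide depends only on the pairwise correlations. -/
theorem sum_signProj_mul {𝓐 : Type*} [Ring 𝓐] [Algebra ℂ 𝓐] (a b c : 𝓐) :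
    ∑ y, signProj a y * (signProj b y * signProj c y) =
      (1 / 4 : ℂ) • (1 + a * b + a * c + b * c) := by
  have h : (1 + a) * ((1 + b) * (1 + c)) + (1 - a) * ((1 - b) * (1 - c)) =
      (2 : ℂ) • (1 + a * b + a * c + b * c) := by
    rw [two_smul]
    noncomm_ring
  simp only [Fin.sum_univ_two, signProj, Fin.val_zero, Fin.val_one, pow_zero, pow_one, one_smul,
    neg_smul, ← sub_eq_add_neg, smul_mul_smul_comm, ← smul_add, h, smul_smul]
  norm_num

end ProjectiveMeasurements

/-! ### Tensor powers and Alice's marginals -/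

section TensorPowers

variable {n : ℕ} {H : Type*}

theorem tensorPiOp_mul [Fintype H] (M N : Fin n → Matrix H H ℂ) :
    tensorPiOp M * tensorPiOp N = tensorPiOp fun i => M i * N i := by
  classical
  ext a b
  simp only [tensorPiOp, Matrix.of_apply, Matrix.mul_apply, ← Finset.prod_mul_distrib]
  rw [Fintype.prod_sum]

theorem tensorPiOp_one [DecidableEq H] : tensorPiOp (fun _ : Fin n => (1 : Matrix H H ℂ)) = 1 := by
  ext a b
  simp only [tensorPiOp, Matrix.of_apply, Matrix.one_apply, Finset.prod_ite_zero,
    Finset.prod_const_one, Finset.mem_univ, true_implies, funext_iff]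

theorem conjTranspose_tensorPiOp (M : Fin n → Matrix H H ℂ) :
    (tensorPiOp M)ᴴ = tensorPiOp fun i => (M i)ᴴ := by
  ext a b
  simp [tensorPiOp, Matrix.conjTranspose_apply]

theorem sum_tensorPiOp_eq {Y : Type*} [Fintype Y] (P : Fin n → Y → Matrix H H ℂ) :
    ∑ y : Fin n → Y, tensorPiOp (fun i => P i (y i)) = tensorPiOp fun i => ∑ y, P i y := by
  ext a b
  simp only [Matrix.sum_apply, tensorPiOp, Matrix.of_apply]
  rw [← Fintype.prod_sum (fun i y => P i y (a i) (b i))]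

theorem tensorPiOp_ketbra (u : Fin n → EuclideanSpace ℂ H) :
    tensorPiOp (fun i => ketbra (u i)) = ketbra (tensorPiVec u) := by
  ext a b
  simp [tensorPiOp, ketbra, tensorPiVec, Matrix.vecMulVec_apply, Finset.prod_mul_distrib]

theorem tensorPiOp_update_apply [DecidableEq H] (i : Fin n) (M : Matrix H H ℂ)
    (a b : Fin n → H) : tensorPiOp (Function.update (fun _ => 1) i M) a b =
      M (a i) (b i) * ∏ j ∈ Finset.univ.erase i, (1 : Matrix H H ℂ) (a j) (b j) := by
  rw [tensorPiOp, Matrix.of_apply, ← Finset.mul_prod_erase _ _ (Finset.mem_univ i),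
    Function.update_self]
  congr 1
  refine Finset.prod_congr rfl fun j hj => ?_
  rw [Function.update_of_ne (Finset.ne_of_mem_erase hj)]

/-- The operators on the `i`-th factor of a tensor power. -/
def factorHom [Fintype H] [DecidableEq H] (i : Fin n) :
    Matrix H H ℂ →⋆ₐ[ℂ] Matrix (Fin n → H) (Fin n → H) ℂ where
  toFun M := tensorPiOp (Function.update (fun _ => 1) i M)
  map_one' := by
    rw [Function.update_eq_self_iff.mpr rfl, tensorPiOp_one]
  map_mul' M N := by
    rw [tensorPiOp_mul]
    congr 1
    funext j
    by_cases h : j = i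
    · subst h
      simp
    · simp [h]
  map_zero' := by
    ext a b
    rw [tensorPiOp_update_apply]
    simp
  map_add' M N := by
    ext a b
    simp only [Matrix.add_apply, tensorPiOp_update_apply, add_mul]
  commutes' r := by
    rw [Algebra.algebraMap_eq_smul_one, Algebra.algebraMap_eq_smul_one, ← tensorPiOp_one]
    conv_rhs => rw [← Function.update_eq_self i (fun _ : Fin n => (1 : Matrix H H ℂ))]
    ext a b
    simp only [Matrix.smul_apply, tensorPiOp_update_apply, smul_eq_mul, mul_assoc]
  map_star' M := by
    rw [Matrix.star_eq_conjTranspose, Matrix.star_eq_conjTranspose, conjTranspose_tensorPiOp]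
    congr 1
    funext j
    by_cases h : j = i
    · subst h
      simp
    · simp [h]

theorem factorHom_apply [Fintype H] [DecidableEq H] (i : Fin n) (M : Matrix H H ℂ) :
    factorHom i M = tensorPiOp (Function.update (fun _ => 1) i M) := rfl

theorem prod_ofFn_factorHom [Fintype H] [DecidableEq H] (M : Fin n → Matrix H H ℂ) :
    (List.ofFn fun i => factorHom i (M i)).prod = tensorPiOp M := by
  have h : ∀ l : List (Fin n), l.Nodup → (l.map fun i => factorHom i (M i)).prod =
      tensorPiOp fun j => if j ∈ l then M j else 1 := fun l hl => by
    induction l with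
    | nil => simp [tensorPiOp_one]
    | cons i l ih =>
      rw [List.nodup_cons] at hl
      rw [List.map_cons, List.prod_cons, ih hl.2, factorHom_apply, tensorPiOp_mul]
      congr 1
      funext j
      by_cases h : j = i
      · subst h
        simp [hl.1]
      · simp [h]
  rw [List.ofFn_eq_map, h _ (List.nodup_finRange n)]
  simp

theorem sum_filter_tensorPiOp {Y : Type*} [Fintype Y] [DecidableEq Y] [Fintype H] [DecidableEq H]
    (P : Fin n → Y → Matrix H H ℂ) (hP : ∀ i, ∑ y, P i y = 1) (i : Fin n) (y : Y) :
    ∑ x : Fin n → Y with x i = y, tensorPiOp (fun j => P j (x j)) = factorHom i (P i y) := by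
  -- The constraint on the `i`-th outcome is absorbed into the `i`-th factor by setting the other
  -- operators there to zero; the sum then runs over all strings and factorizes.
  have h := sum_tensorPiOp_eq fun j z => if j = i ∧ z ≠ y then 0 else P j z
  rw [Finset.sum_filter, factorHom_apply]
  convert h using 1
  · refine Finset.sum_congr rfl fun x _ => ?_
    split_ifs with hx
    · congr 1
      funext j
      rw [if_neg]
      rintro ⟨rfl, h1⟩
      exact h1 hx
    · ext a b
      rw [tensorPiOp, Matrix.of_apply, Finset.prod_eq_zero (Finset.mem_univ i)]
      · rfl
      · simp [hx]
  · congr 1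
    funext j
    by_cases hj : j = i
    · subst hj
      simp [ite_not]
    · simp [hj, hP]

theorem MoEGame.marginal_alice_op {Θ Y : Type*} [Fintype Θ] [Fintype Y] [DecidableEq Y]
    [Fintype H] [DecidableEq H] (G : MoEGame Θ Y H) (θ : Fin n → Θ) (i : Fin n) (y : Y) :
    (((G.parallel n).alice θ).marginal i).op y = factorHom i ((G.alice (θ i)).op y) :=
  sum_filter_tensorPiOp (fun j => (G.alice (θ j)).op) (fun j => (G.alice (θ j)).sum_eq_one) i y

end TensorPowers

/-! ### Pauli operators and Breidbart states -/

section Qubit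

theorem observable_alice_zero : (TFKW.alice 0).observable = pauliZ := by
  ext a b
  fin_cases a <;> fin_cases b <;>
    simp [POVM.observable, TFKW, ketbra, conjugateCoding, ap, qubitKet, pauliZ,
      Matrix.vecMulVec_apply]

theorem observable_alice_one : (TFKW.alice 1).observable = pauliX := by
  have h2 : ((Real.sqrt 2 : ℝ) : ℂ)⁻¹ * ((Real.sqrt 2 : ℝ) : ℂ)⁻¹ = 1 / 2 := by
    rw [← mul_inv, ← Complex.ofReal_mul, Real.mul_self_sqrt (by norm_num)]
    norm_num
  ext a b
  fin_cases a <;> fin_cases b <;>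
    simp [POVM.observable, TFKW, ketbra, conjugateCoding, ap, qubitKet, hadamardOp, pauliX,
      Matrix.vecMulVec_apply, h2] <;> norm_num

theorem pauliZ_mul_pauliX : pauliZ * pauliX = -(pauliX * pauliZ) := by
  ext a b
  fin_cases a <;> fin_cases b <;> simp [pauliX, pauliZ]

theorem pauliX_mul_self : pauliX * pauliX = 1 := by
  ext a b
  fin_cases a <;> fin_cases b <;> simp [pauliX]

theorem pauliZ_mul_self : pauliZ * pauliZ = 1 := by
  ext a b
  fin_cases a <;> fin_cases b <;> simp [pauliZ]

theorem isHermitian_pauliX : pauliX.IsHermitian := by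
  ext a b
  fin_cases a <;> fin_cases b <;> simp [pauliX]

theorem isHermitian_pauliZ : pauliZ.IsHermitian := by
  ext a b
  fin_cases a <;> fin_cases b <;> simp [pauliZ]

theorem cos_sq_pi_div_eight : Real.cos (Real.pi / 8) ^ 2 = 1 / 2 + √2 / 4 := by
  rw [Real.cos_sq, show 2 * (Real.pi / 8) = Real.pi / 4 by ring, Real.cos_pi_div_four]
  ring

theorem sin_sq_pi_div_eight : Real.sin (Real.pi / 8) ^ 2 = 1 / 2 - √2 / 4 := by
  rw [Real.sin_sq, cos_sq_pi_div_eight]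
  ring

theorem cos_mul_sin_pi_div_eight :
    Real.cos (Real.pi / 8) * Real.sin (Real.pi / 8) = √2 / 4 := by
  have h := Real.sin_two_mul (Real.pi / 8)
  rw [show 2 * (Real.pi / 8) = Real.pi / 4 by ring, Real.sin_pi_div_four] at h
  linarith

theorem ofLp_breidbart : breidbart.ofLp =
    ![(Real.cos (Real.pi / 8) : ℂ), (Real.sin (Real.pi / 8) : ℂ)] := by
  funext a
  fin_cases a <;> simp [breidbart, ap, qubitKet, breidbartOp, -Real.cos_pi_div_eight,
    -Real.sin_pi_div_eight]

/-- The projector onto a Breidbart state is a spectral projector of the corresponding combination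
of the Pauli operators. -/
theorem signProj_mixedObs_pauli (s : Fin 2 → Fin 2) :
    signProj (mixedObs pauliZ pauliX (s 0) (s 1)) 0 = ketbra (wiesnerBreidbart s) := by
  have hcc : (Real.cos (Real.pi / 8) : ℂ) * Real.cos (Real.pi / 8) = 1 / 2 + (√2 : ℝ) / 4 := by
    rw [← Complex.ofReal_mul, ← sq, cos_sq_pi_div_eight]
    push_cast
    rfl
  have hss : (Real.sin (Real.pi / 8) : ℂ) * Real.sin (Real.pi / 8) = 1 / 2 - (√2 : ℝ) / 4 := by
    rw [← Complex.ofReal_mul, ← sq, sin_sq_pi_div_eight]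
    push_cast
    rfl
  have hcs : (Real.cos (Real.pi / 8) : ℂ) * Real.sin (Real.pi / 8) = (√2 : ℝ) / 4 := by
    rw [← Complex.ofReal_mul, cos_mul_sin_pi_div_eight]
    push_cast
    rfl
  have hsc : (Real.sin (Real.pi / 8) : ℂ) * Real.cos (Real.pi / 8) = (√2 : ℝ) / 4 := by
    rw [mul_comm, hcs]
  have hinv : ((√2 : ℝ) : ℂ)⁻¹ = (√2 : ℝ) / 2 := by
    rw [← Complex.ofReal_inv, ← Real.sqrt_div_self]
    push_cast
    rfl
  rw [signProj, mixedObs, hinv]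
  rw [ketbra, wiesnerBreidbart, ap, ofLp_breidbart]
  generalize s 0 = s0
  generalize s 1 = s1
  -- Only the products of cosine and sine enter, through the identities above. Conjugation by X
  -- flips the sign of Z and vice versa, which accounts for the four cases.
  generalize Real.cos (Real.pi / 8) = c at *
  generalize Real.sin (Real.pi / 8) = d at *
  ext a b
  fin_cases s0 <;> fin_cases s1 <;> fin_cases a <;> fin_cases b <;>
    simp [pauliX, pauliZ, Matrix.vecMulVec_apply, hcc, hss, hcs, hsc] <;> ring

end Qubit

/-! ### From winning probabilities to rounds -/

section Strategies

variable {n : ℕ} {B C R : Type*} [Fintype B] [DecidableEq B] [Fintype C] [DecidableEq C]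
  [Fintype R] [DecidableEq R]

/-- The correlations of the three players in the `i`-th round, for the question string `θ`. -/
def PurifiedStrategy.roundValue (S : PurifiedStrategy (TFKW.parallel n) B C R) (i : Fin n)
    (θ : Fin n → Fin 2) : ℝ :=
  let a := aliceHom (Fin n → Fin 2) B C R (factorHom i (TFKW.alice (θ i)).observable)
  let b := bobHom (Fin n → Fin 2) B C R ((S.bob θ).marginal i).observable
  let c := charlieHom (Fin n → Fin 2) B C R ((S.charlie θ).marginal i).observable
  reInner S.state (a (b S.state)) + reInner S.state (a (c S.state)) +
    reInner S.state (b (c S.state))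

theorem PurifiedStrategy.roundWinProb_eq (S : PurifiedStrategy (TFKW.parallel n) B C R)
    (i : Fin n) :
    S.roundWinProb i = ∑ θ, (1 / 2) ^ n * ((1 / 4) * (1 + S.roundValue i θ)) := by
  refine Finset.sum_congr rfl fun θ _ => ?_
  have hprob : (TFKW.parallel n).prob θ = (1 / 2) ^ n := by
    simp [MoEGame.parallel, TFKW]
  rw [hprob]
  congr 1
  simp only [trace_mul_ketbra_re, ← aliceHom_mul_bobHom_mul_charlieHom]
  simp only [MoEGame.marginal_alice_op]
  simp only [POVM.op_eq_signProj, map_signProj]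
  set a := aliceHom (Fin n → Fin 2) B C R (factorHom i (TFKW.alice (θ i)).observable) with ha
  set b := bobHom (Fin n → Fin 2) B C R ((S.bob θ).marginal i).observable with hb
  set c := charlieHom (Fin n → Fin 2) B C R ((S.charlie θ).marginal i).observable with hc
  have h := congrArg (fun T => reInner S.state (T S.state)) (sum_signProj_mul a b c)
  have h4 : (1 / 4 : ℂ) = ((1 / 4 : ℝ) : ℂ) := by norm_num
  simp only [Fin.sum_univ_two, add_apply, smul_apply,
    reInner_add_right, h4, reInner_smul_right, one_apply_eq_self, reInner_self,
    S.norm_state, mul_apply_eq_comp] at h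
  simp only [Fin.sum_univ_two, mul_apply_eq_comp, h, PurifiedStrategy.roundValue, ← ha, ← hb, ← hc]
  ring

/-- Some string for the questions of the other rounds does not decrease the winning
probability. -/
theorem PurifiedStrategy.exists_le_roundValue (S : PurifiedStrategy (TFKW.parallel n) B C R)
    (i : Fin n) {ε : ℝ} (h : Real.cos (Real.pi / 8) ^ 2 - ε ≤ S.roundWinProb i) :
    ∃ φ : Fin n → Fin 2, φ i = 0 ∧ 2 + 2 * √2 - 8 * ε ≤
      S.roundValue i (φ + Pi.single i 0) + S.roundValue i (φ + Pi.single i 1) := by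
  have h11 : (Pi.single i 1 + Pi.single i 1 : Fin n → Fin 2) = 0 := by
    rw [← Pi.single_add]
    exact Pi.single_zero i
  have hex : ∃ θ : Fin n → Fin 2, 2 + 2 * √2 - 8 * ε ≤
      S.roundValue i θ + S.roundValue i (θ + Pi.single i 1) := by
    by_contra! hlt
    -- If every pair of strings that differ at `i` fell short, so would the average: shifting by 1^i
    -- permutes the strings, and the sum over pairs counts each value twice.
    have h1 : ∑ θ, (S.roundValue i θ + S.roundValue i (θ + Pi.single i 1)) <
        ∑ _θ : Fin n → Fin 2, (2 + 2 * √2 - 8 * ε) :=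
      Finset.sum_lt_sum_of_nonempty Finset.univ_nonempty fun θ _ => hlt θ
    have hshift := Equiv.sum_comp (Equiv.addRight (Pi.single i 1)) (S.roundValue i)
    simp only [Equiv.coe_addRight] at hshift
    rw [Finset.sum_add_distrib, hshift] at h1
    rw [S.roundWinProb_eq, ← Finset.mul_sum, ← Finset.mul_sum, Finset.sum_add_distrib,
      cos_sq_pi_div_eight] at h
    simp only [Finset.sum_const, Finset.card_univ, Fintype.card_fun, Fintype.card_fin,
      nsmul_eq_mul] at h h1
    push_cast at h h1
    have h2 : (1 / 2 : ℝ) ^ n * 2 ^ n = 1 := by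
      rw [← mul_pow]
      norm_num
    have h3 : (0 : ℝ) < (1 / 2) ^ n := by positivity
    have h4 := mul_lt_mul_of_pos_left h1 h3
    rw [← mul_assoc, h2] at h4
    have h5 : (1 / 2 : ℝ) ^ n * (1 / 4 * (2 ^ n * 1 + ∑ θ, S.roundValue i θ)) =
        1 / 4 + 1 / 4 * ((1 / 2 : ℝ) ^ n * ∑ θ, S.roundValue i θ) := by
      linear_combination (1 / 4) * h2
    rw [h5] at h
    linarith
  obtain ⟨θ, hθ⟩ := hex
  by_cases h0 : θ i = 0
  · exact ⟨θ, h0, by simpa using hθ⟩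
  -- If the bit at `i` is 1, the other member of the same pair serves, since adding 1^i twice gives
  -- back θ.
  · refine ⟨θ + Pi.single i 1, ?_, ?_⟩
    · have : θ i = 1 := by omega
      simp [this]
    · rw [Pi.single_zero, add_zero, add_assoc, h11, add_zero]
      linarith

/-- The observables of Alice in the `i`-th round. -/
def aliceObs (n : ℕ) (B C R : Type*) [Fintype B] [DecidableEq B] [Fintype C] [DecidableEq C]
    [Fintype R] [DecidableEq R] (i : Fin n) (θ : Fin 2) :
    EuclideanSpace ℂ ((Fin n → Fin 2) × B × C × R) →L[ℂ]
      EuclideanSpace ℂ ((Fin n → Fin 2) × B × C × R) :=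
  aliceHom (Fin n → Fin 2) B C R (factorHom i (TFKW.alice θ).observable)

theorem PurifiedStrategy.isRound (S : PurifiedStrategy (TFKW.parallel n) B C R) {i : Fin n}
    {φ : Fin n → Fin 2} {ε : ℝ} (hφ : φ i = 0) (h : 2 + 2 * √2 - 8 * ε ≤
      S.roundValue i (φ + Pi.single i 0) + S.roundValue i (φ + Pi.single i 1)) :
    IsRound (aliceObs n B C R i 0) (aliceObs n B C R i 1)
      (bobHom _ B C R (S.bobObs φ i 0)) (bobHom _ B C R (S.bobObs φ i 1))
      (charlieHom _ B C R (S.charlieObs φ i 0)) (charlieHom _ B C R (S.charlieObs φ i 1))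
      S.state ε where
  hZ := by
    refine isReflection_map _ ?_ ?_ <;> rw [observable_alice_zero]
    · exact isHermitian_pauliZ.isSelfAdjoint.map (factorHom i)
    · rw [← map_mul, pauliZ_mul_self, map_one]
  hX := by
    refine isReflection_map _ ?_ ?_ <;> rw [observable_alice_one]
    · exact isHermitian_pauliX.isSelfAdjoint.map (factorHom i)
    · rw [← map_mul, pauliX_mul_self, map_one]
  hB₀ := isReflection_map _ (POVM.isHermitian_observable _)
    ((S.bob_projective _).observable_mul_self i)
  hB₁ := isReflection_map _ (POVM.isHermitian_observable _)
    ((S.bob_projective _).observable_mul_self i)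
  hC₀ := isReflection_map _ (POVM.isHermitian_observable _)
    ((S.charlie_projective _).observable_mul_self i)
  hC₁ := isReflection_map _ (POVM.isHermitian_observable _)
    ((S.charlie_projective _).observable_mul_self i)
  anti := by
    rw [aliceObs, aliceObs, ← map_mul, ← map_mul, observable_alice_zero, observable_alice_one,
      pauliZ_mul_pauliX, map_neg, map_neg, map_mul, map_mul]
  ZB₀ := commute_aliceHom_bobHom _ _ _ _ _ _
  ZB₁ := commute_aliceHom_bobHom _ _ _ _ _ _
  ZC₀ := commute_aliceHom_charlieHom _ _ _ _ _ _
  ZC₁ := commute_aliceHom_charlieHom _ _ _ _ _ _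
  XB₀ := commute_aliceHom_bobHom _ _ _ _ _ _
  XB₁ := commute_aliceHom_bobHom _ _ _ _ _ _
  XC₀ := commute_aliceHom_charlieHom _ _ _ _ _ _
  XC₁ := commute_aliceHom_charlieHom _ _ _ _ _ _
  BC₀₀ := commute_bobHom_charlieHom _ _ _ _ _ _
  BC₀₁ := commute_bobHom_charlieHom _ _ _ _ _ _
  BC₁₀ := commute_bobHom_charlieHom _ _ _ _ _ _
  BC₁₁ := commute_bobHom_charlieHom _ _ _ _ _ _
  norm_state := S.norm_state
  value := by
    have e : ∀ θ, (φ + Pi.single i θ : Fin n → Fin 2) i = θ := fun θ => by simp [hφ]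
    simp only [PurifiedStrategy.roundValue, e] at h
    simp only [aliceObs, PurifiedStrategy.bobObs, PurifiedStrategy.charlieObs]
    linarith

end Strategies

/-! ### Isometries that record outcomes -/

section Dilations

theorem star_signProj {𝓐 : Type*} [Ring 𝓐] [StarRing 𝓐] [Algebra ℂ 𝓐] [StarModule ℂ 𝓐] {T : 𝓐}
    (hT : IsSelfAdjoint T) (s : Fin 2) : star (signProj T s) = signProj T s := by
  simp [signProj, hT.star_eq]

theorem sum_signProj_mul_self {𝓐 : Type*} [Ring 𝓐] [Algebra ℂ 𝓐] {T : 𝓐} (h : T * T = 1) :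
    ∑ s, signProj T s * signProj T s = 1 := by
  have e : (1 + T) * (1 + T) + (1 - T) * (1 - T) = (4 : ℂ) • 1 := by
    have : (1 + T) * (1 + T) + (1 - T) * (1 - T) = 2 • 1 + 2 • (T * T) := by noncomm_ring
    rw [this, h]
    module
  simp only [Fin.sum_univ_two, signProj, Fin.val_zero, Fin.val_one, pow_zero, pow_one, one_smul,
    neg_smul, ← sub_eq_add_neg, smul_mul_smul_comm, ← smul_add, e, smul_smul]
  norm_num

/-- The later measurements stand in the middle of the product and sum to 1 by induction, which
leaves the first measurement. This completeness relation makes `seqIsometry` an isometry. -/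
theorem sum_star_seqProj_mul {𝓐 : Type*} [Ring 𝓐] [StarRing 𝓐] [Algebra ℂ 𝓐] [StarModule ℂ 𝓐]
    {m : ℕ} {T : Fin m → 𝓐} (hT : ∀ k, IsSelfAdjoint (T k)) (h : ∀ k, T k * T k = 1) :
    ∑ t, star (seqProj T t) * seqProj T t = 1 := by
  induction m with
  | zero => simp [seqProj]
  | succ m ih =>
    have e : ∀ (p q : 𝓐), star (q * p) * (q * p) = star p * (star q * q) * p := fun p q => by
      rw [star_mul]
      noncomm_ring
    simp only [sum_fin_succ_arrow, seqProj, Fin.tail_cons, Fin.cons_zero, e, ← Finset.sum_mul,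
      ← Finset.mul_sum]
    have ih' := ih (T := Fin.tail T) (fun k => hT k.succ) fun k => h k.succ
    simp only [ih', mul_one, star_signProj (hT 0), sum_signProj_mul_self (h 0)]

variable {m : ℕ} {A B C R : Type*}

/-- The isometry that performs a sequence of two-outcome measurements and records the outcomes in
an additional register. -/
def seqIsometry [Fintype B] [DecidableEq B] (T : Fin m → Matrix B B ℂ) :
    Matrix (B × (Fin m → Fin 2)) B ℂ :=
  Matrix.of fun p b => seqProj T p.2 p.1 b

/-- The observable of the `k`-th recorded outcome. -/
def signObs (B : Type*) [DecidableEq B] (k : Fin m) :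
    Matrix (B × (Fin m → Fin 2)) (B × (Fin m → Fin 2)) ℂ :=
  Matrix.diagonal fun p => (-1 : ℂ) ^ (p.2 k : ℕ)

theorem isIsometryOp_seqIsometry [Fintype B] [DecidableEq B] {T : Fin m → Matrix B B ℂ}
    (hT : ∀ k, (T k).IsHermitian) (h : ∀ k, T k * T k = 1) : IsIsometryOp (seqIsometry T) := by
  have h1 := sum_star_seqProj_mul (fun k => (hT k).isSelfAdjoint) h
  rw [IsIsometryOp, ← h1]
  ext b b'
  simp only [Matrix.mul_apply, Matrix.sum_apply, Matrix.conjTranspose_apply,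
    Matrix.star_eq_conjTranspose, Fintype.sum_prod_type_right]
  rfl

theorem isUnitaryObservable_signObs [Fintype B] [DecidableEq B] (k : Fin m) :
    IsUnitaryObservable (signObs B k) := by
  have h : ((signObs B k)ᴴ : Matrix _ _ ℂ) = signObs B k := by
    rw [signObs, Matrix.diagonal_conjTranspose]
    congr 1
    funext p
    simp
  refine ⟨h, ?_⟩
  rw [Matrix.mem_unitaryGroup_iff, Matrix.star_eq_conjTranspose, h, signObs,
    Matrix.diagonal_mul_diagonal, ← Matrix.diagonal_one]
  congr 1
  funext p
  rw [← mul_pow]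
  simp

theorem commute_signObs [Fintype B] [DecidableEq B] (k l : Fin m) :
    Commute (signObs B k) (signObs B l) := by
  rw [Commute, SemiconjBy, signObs, signObs, Matrix.diagonal_mul_diagonal,
    Matrix.diagonal_mul_diagonal]
  simp only [mul_comm]

variable [Fintype A] [DecidableEq A] [Fintype B] [Fintype C] [Fintype R] [DecidableEq R]

theorem ap_onBob_apply [DecidableEq C] {B' : Type*} (M : Matrix B' B ℂ)
    (x : EuclideanSpace ℂ (A × B × C × R)) (a : A) (p : B') (c : C) (r : R) :
    ap (onBob A C R M) x (a, p, c, r) = ∑ b, M p b * x (a, b, c, r) := by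
  simp [ap, onBob, Matrix.mulVec, dotProduct, Fintype.sum_prod_type, Matrix.one_apply,
    Finset.sum_ite_irrel]

theorem ap_onCharlie_apply [DecidableEq B] {C' : Type*} (M : Matrix C' C ℂ)
    (x : EuclideanSpace ℂ (A × B × C × R)) (a : A) (b : B) (p : C') (r : R) :
    ap (onCharlie A B R M) x (a, b, p, r) = ∑ c, M p c * x (a, b, c, r) := by
  simp [ap, onCharlie, Matrix.mulVec, dotProduct, Fintype.sum_prod_type, Matrix.one_apply,
    Finset.sum_ite_irrel]

theorem ap_isometries_apply {B' C' : Type*} (V : Matrix B' B ℂ) (W : Matrix C' C ℂ)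
    (x : EuclideanSpace ℂ (A × B × C × R)) (a : A) (p : B') (q : C') (r : R) :
    ap ((1 : Matrix A A ℂ) ⊗ₖ (V ⊗ₖ (W ⊗ₖ (1 : Matrix R R ℂ)))) x (a, p, q, r) =
      ∑ b, V p b * ∑ c, W q c * x (a, b, c, r) := by
  simp [ap, Matrix.mulVec, dotProduct, Fintype.sum_prod_type, Matrix.one_apply,
    Finset.sum_ite_irrel, Finset.mul_sum, mul_assoc]

variable [DecidableEq B] [DecidableEq C]

theorem bobHom_apply (M : Matrix B B ℂ) (x : EuclideanSpace ℂ (A × B × C × R)) :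
    bobHom A B C R M x = ap (onBob A C R M) x := by
  rw [onBob, Matrix.one_kronecker_one]
  rfl

theorem charlieHom_apply (M : Matrix C C ℂ) (x : EuclideanSpace ℂ (A × B × C × R)) :
    charlieHom A B C R M x = ap (onCharlie A B R M) x := rfl

/-- Splits a vector on an enlarged register into its components for each recorded outcome; thus the
ℓ² estimates become estimates of norms. -/
theorem norm_eq_l2norm_of_equiv {S X Y : Type*} [Fintype S] [Fintype X] [Fintype Y]
    (e : S × X ≃ Y) (y : EuclideanSpace ℂ Y) (f : S → EuclideanSpace ℂ X)
    (h : ∀ s x, y (e (s, x)) = f s x) : ‖y‖ = l2norm f := by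
  refine (sq_eq_sq₀ (norm_nonneg _) (l2norm_nonneg _)).mp ?_
  rw [l2norm_sq, EuclideanSpace.norm_sq_eq, ← e.sum_comp, Fintype.sum_prod_type]
  simp only [EuclideanSpace.norm_sq_eq, h]

theorem norm_onBob_seqIsometry_sub (T : Fin m → Matrix B B ℂ) (N : Matrix B B ℂ) (k : Fin m)
    (x : EuclideanSpace ℂ (A × B × C × R)) :
    ‖ap (onBob A C R (seqIsometry T * N)) x - ap (onBob A C R (signObs B k * seqIsometry T)) x‖ =
      l2norm fun t => seqProj (fun j => bobHom A B C R (T j)) t (bobHom A B C R N x) -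
        (-1 : ℂ) ^ (t k : ℕ) • seqProj (fun j => bobHom A B C R (T j)) t x := by
  let e : (Fin m → Fin 2) × (A × B × C × R) ≃ A × (B × (Fin m → Fin 2)) × C × R :=
    { toFun := fun p => (p.2.1, (p.2.2.1, p.1), p.2.2.2)
      invFun := fun p => (p.2.1.2, p.1, p.2.1.1, p.2.2)
      left_inv := fun _ => rfl
      right_inv := fun _ => rfl }
  refine norm_eq_l2norm_of_equiv e _ _ fun t p => ?_
  obtain ⟨a, b, c, r⟩ := p
  have h : ∀ y, seqProj (fun j => bobHom A B C R (T j)) t y = bobHom A B C R (seqProj T t) y :=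
    fun y => by rw [map_seqProj]
  have h' : seqProj (fun j => bobHom A B C R (T j)) t (bobHom A B C R N x) =
      bobHom A B C R (seqProj T t * N) x := by rw [h, map_mul, mul_apply_eq_comp]
  rw [h', h, bobHom_apply, bobHom_apply]
  simp only [PiLp.sub_apply, PiLp.smul_apply, smul_eq_mul, e, Equiv.coe_fn_mk, ap_onBob_apply,
    signObs, Matrix.diagonal_mul, Finset.mul_sum, mul_assoc]
  rfl

theorem norm_onCharlie_seqIsometry_sub (T : Fin m → Matrix C C ℂ) (N : Matrix C C ℂ) (k : Fin m)
    (x : EuclideanSpace ℂ (A × B × C × R)) :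
    ‖ap (onCharlie A B R (seqIsometry T * N)) x -
        ap (onCharlie A B R (signObs C k * seqIsometry T)) x‖ =
      l2norm fun t => seqProj (fun j => charlieHom A B C R (T j)) t (charlieHom A B C R N x) -
        (-1 : ℂ) ^ (t k : ℕ) • seqProj (fun j => charlieHom A B C R (T j)) t x := by
  let e : (Fin m → Fin 2) × (A × B × C × R) ≃ A × B × (C × (Fin m → Fin 2)) × R :=
    { toFun := fun p => (p.2.1, p.2.2.1, (p.2.2.2.1, p.1), p.2.2.2.2)
      invFun := fun p => (p.2.2.1.2, p.1, p.2.1, p.2.2.1.1, p.2.2.2)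
      left_inv := fun _ => rfl
      right_inv := fun _ => rfl }
  refine norm_eq_l2norm_of_equiv e _ _ fun t p => ?_
  obtain ⟨a, b, c, r⟩ := p
  have h : ∀ y, seqProj (fun j => charlieHom A B C R (T j)) t y =
      charlieHom A B C R (seqProj T t) y := fun y => by rw [map_seqProj]
  have h' : seqProj (fun j => charlieHom A B C R (T j)) t (charlieHom A B C R N x) =
      charlieHom A B C R (seqProj T t * N) x := by rw [h, map_mul, mul_apply_eq_comp]
  rw [h', h, charlieHom_apply, charlieHom_apply]
  simp only [PiLp.sub_apply, PiLp.smul_apply, smul_eq_mul, e, Equiv.coe_fn_mk, ap_onCharlie_apply,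
    signObs, Matrix.diagonal_mul, Finset.mul_sum, mul_assoc]
  rfl

theorem ap_seqIsometry_apply (T : Fin m → Matrix B B ℂ) (U : Fin m → Matrix C C ℂ)
    (x : EuclideanSpace ℂ (A × B × C × R)) (a : A) (b : B) (s : Fin m → Fin 2) (c : C)
    (s' : Fin m → Fin 2) (r : R) :
    ap ((1 : Matrix A A ℂ) ⊗ₖ (seqIsometry T ⊗ₖ (seqIsometry U ⊗ₖ (1 : Matrix R R ℂ)))) x
        (a, (b, s), (c, s'), r) =
      dilate (fun j => bobHom A B C R (T j)) (fun j => charlieHom A B C R (U j)) x (s, s')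
        (a, b, c, r) := by
  rw [ap_isometries_apply, dilate, ← map_seqProj, ← map_seqProj, bobHom_apply, ap_onBob_apply]
  refine Finset.sum_congr rfl fun b' _ => ?_
  rw [charlieHom_apply, ap_onCharlie_apply]
  rfl

end Dilations

/-! ### Vectors whose registers hold a fixed string -/

section Superpositions

variable {n : ℕ} {B C R : Type*}

/-- The strings `t` as assignments of a bit to each observable of a player. -/
def bitsEquiv (n : ℕ) : (Fin n → Fin 2 → Fin 2) ≃ (Fin (n * 2) → Fin 2) where
  toFun t := obsSeq t
  invFun s i θ := s (obsIndex i θ)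
  left_inv t := by
    funext i θ
    exact obsSeq_obsIndex t i θ
  right_inv s := by
    funext k
    exact congrArg s (finProdFinEquiv.apply_symm_apply k)

theorem bitsEquiv_apply_obsIndex (t : Fin n → Fin 2 → Fin 2) (i : Fin n) (θ : Fin 2) :
    bitsEquiv n t (obsIndex i θ) = t i θ := obsSeq_obsIndex t i θ

/-- Families of vectors such that the registers of both players hold the index `t` in the vector
`ψ t`. -/
def IsRecorded (ψ : (Fin n → Fin 2 → Fin 2) →
    EuclideanSpace ℂ ((B × (Fin (n * 2) → Fin 2)) × (C × (Fin (n * 2) → Fin 2)) × R)) : Prop :=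
  ∀ t b s c s' r, s ≠ bitsEquiv n t ∨ s' ≠ bitsEquiv n t → ψ t ((b, s), (c, s'), r) = 0

variable {ψ : (Fin n → Fin 2 → Fin 2) →
    EuclideanSpace ℂ ((B × (Fin (n * 2) → Fin 2)) × (C × (Fin (n * 2) → Fin 2)) × R)}

theorem IsRecorded.isOrtho_supportBob [Fintype B] (hψ : IsRecorded ψ)
    {t t' : Fin n → Fin 2 → Fin 2} (h : t ≠ t') : supportBob (ψ t) ⟂ supportBob (ψ t') := by
  rw [supportBob, supportBob, Submodule.isOrtho_span]
  rintro _ ⟨⟨⟨c, s'⟩, r⟩, rfl⟩ _ ⟨⟨⟨c', s''⟩, r'⟩, rfl⟩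
  rw [PiLp.inner_apply]
  refine Finset.sum_eq_zero ?_
  rintro ⟨b, s⟩ -
  by_cases hs : s = bitsEquiv n t
  · have : s ≠ bitsEquiv n t' := fun h' => h ((bitsEquiv n).injective (hs.symm.trans h'))
    simp [hψ t' b s c' s'' r' (Or.inl this)]
  · simp [hψ t b s c s' r (Or.inl hs)]

theorem IsRecorded.isOrtho_supportCharlie [Fintype C] (hψ : IsRecorded ψ)
    {t t' : Fin n → Fin 2 → Fin 2} (h : t ≠ t') :
    supportCharlie (ψ t) ⟂ supportCharlie (ψ t') := by
  rw [supportCharlie, supportCharlie, Submodule.isOrtho_span]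
  rintro _ ⟨⟨⟨b, s⟩, r⟩, rfl⟩ _ ⟨⟨⟨b', s''⟩, r'⟩, rfl⟩
  rw [PiLp.inner_apply]
  refine Finset.sum_eq_zero ?_
  rintro ⟨c, s'⟩ -
  by_cases hs : s' = bitsEquiv n t
  · have : s' ≠ bitsEquiv n t' := fun h' => h ((bitsEquiv n).injective (hs.symm.trans h'))
    simp [hψ t' b' s'' c s' r' (Or.inr this)]
  · simp [hψ t b s c s' r (Or.inr hs)]

variable [Fintype B] [DecidableEq B] [Fintype C] [DecidableEq C] [Fintype R] [DecidableEq R]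

theorem ap_diagonal_apply {X : Type*} [Fintype X] [DecidableEq X] (d : X → ℂ)
    (x : EuclideanSpace ℂ X) (p : X) : ap (Matrix.diagonal d) x p = d p * x p :=
  Matrix.mulVec_diagonal _ _ _

theorem IsRecorded.ap_signObs_bob (hψ : IsRecorded ψ) (i : Fin n) (θ : Fin 2)
    (t : Fin n → Fin 2 → Fin 2) :
    ap (signObs B (obsIndex i θ) ⊗ₖ
      ((1 : Matrix (C × (Fin (n * 2) → Fin 2)) (C × (Fin (n * 2) → Fin 2)) ℂ) ⊗ₖ
        (1 : Matrix R R ℂ))) (ψ t) = (-1 : ℂ) ^ (t i θ : ℕ) • ψ t := by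
  rw [Matrix.one_kronecker_one, ← Matrix.diagonal_one, signObs,
    Matrix.diagonal_kronecker_diagonal]
  ext ⟨⟨b, s⟩, ⟨c, s'⟩, r⟩
  rw [ap_diagonal_apply, PiLp.smul_apply, smul_eq_mul, mul_one]
  by_cases hs : s = bitsEquiv n t
  · simp only [hs, bitsEquiv_apply_obsIndex]
  · rw [hψ t b s c s' r (Or.inl hs), mul_zero, mul_zero]

theorem IsRecorded.ap_signObs_charlie (hψ : IsRecorded ψ) (i : Fin n) (θ : Fin 2)
    (t : Fin n → Fin 2 → Fin 2) :
    ap ((1 : Matrix (B × (Fin (n * 2) → Fin 2)) (B × (Fin (n * 2) → Fin 2)) ℂ) ⊗ₖ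
      (signObs C (obsIndex i θ) ⊗ₖ (1 : Matrix R R ℂ))) (ψ t) =
        (-1 : ℂ) ^ (t i θ : ℕ) • ψ t := by
  rw [← Matrix.diagonal_one, ← Matrix.diagonal_one, signObs,
    Matrix.diagonal_kronecker_diagonal, Matrix.diagonal_kronecker_diagonal]
  ext ⟨⟨b, s⟩, ⟨c, s'⟩, r⟩
  rw [ap_diagonal_apply, PiLp.smul_apply, smul_eq_mul, mul_one, one_mul]
  by_cases hs : s' = bitsEquiv n t
  · simp only [hs, bitsEquiv_apply_obsIndex]
  · rw [hψ t b s c s' r (Or.inr hs), mul_zero, mul_zero]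

end Superpositions

/-! ### The projected state and its normalization -/

section Projection

variable {n : ℕ} {B C R : Type*}

theorem breidbartSuperposition_apply (ψ : (Fin n → Fin 2 → Fin 2) → EuclideanSpace ℂ (B × C × R))
    (a : Fin n → Fin 2) (p : B × C × R) : breidbartSuperposition ψ (a, p) =
      ∑ t, tensorPiVec (fun i => wiesnerBreidbart (t i)) a * ψ t p := by
  simp [breidbartSuperposition, tensorVec]

theorem breidbartSuperposition_smul (r : ℂ)
    (ψ : (Fin n → Fin 2 → Fin 2) → EuclideanSpace ℂ (B × C × R)) :
    breidbartSuperposition (fun t => r • ψ t) = r • breidbartSuperposition ψ := by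
  ext ⟨a, p⟩
  rw [PiLp.smul_apply, breidbartSuperposition_apply, breidbartSuperposition_apply, smul_eq_mul,
    Finset.mul_sum]
  refine Finset.sum_congr rfl fun t _ => ?_
  rw [PiLp.smul_apply, smul_eq_mul]
  ring

theorem IsRecorded.smul {ψ : (Fin n → Fin 2 → Fin 2) →
    EuclideanSpace ℂ ((B × (Fin (n * 2) → Fin 2)) × (C × (Fin (n * 2) → Fin 2)) × R)}
    (hψ : IsRecorded ψ) (r : ℂ) : IsRecorded fun t => r • ψ t := fun t b s c s' q h => by
  rw [PiLp.smul_apply, hψ t b s c s' q h, smul_zero]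

/-- The part of a vector in which both registers hold the string `t` and the qubits are in the
states given by `t`. -/
def recordedPart (χ : EuclideanSpace ℂ ((Fin n → Fin 2) × (B × (Fin (n * 2) → Fin 2)) ×
      (C × (Fin (n * 2) → Fin 2)) × R)) (t : Fin n → Fin 2 → Fin 2) :
    EuclideanSpace ℂ ((B × (Fin (n * 2) → Fin 2)) × (C × (Fin (n * 2) → Fin 2)) × R) :=
  WithLp.toLp 2 fun p => if p.1.2 = bitsEquiv n t ∧ p.2.1.2 = bitsEquiv n t then
    ∑ a, star (tensorPiVec (fun i => wiesnerBreidbart (t i)) a) * χ (a, p) else 0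

theorem isRecorded_recordedPart (χ : EuclideanSpace ℂ ((Fin n → Fin 2) ×
    (B × (Fin (n * 2) → Fin 2)) × (C × (Fin (n * 2) → Fin 2)) × R)) :
    IsRecorded (recordedPart χ) := fun t b s c s' r h => by
  simp only [recordedPart]
  rw [if_neg]
  tauto

/-- For given records only the term whose `t` equals both survives. The superposition of the
recorded parts is therefore the orthogonal projection of `χ`, with a rank-one projector on the
qubits for each record. -/
theorem breidbartSuperposition_recordedPart_apply
    (χ : EuclideanSpace ℂ ((Fin n → Fin 2) × (B × (Fin (n * 2) → Fin 2)) ×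
      (C × (Fin (n * 2) → Fin 2)) × R)) (a : Fin n → Fin 2) (b : B) (s : Fin (n * 2) → Fin 2)
    (c : C) (s' : Fin (n * 2) → Fin 2) (r : R) :
    breidbartSuperposition (recordedPart χ) (a, (b, s), (c, s'), r) = if s = s' then
      tensorPiVec (fun i => wiesnerBreidbart ((bitsEquiv n).symm s i)) a *
        ∑ a', star (tensorPiVec (fun i => wiesnerBreidbart ((bitsEquiv n).symm s i)) a') *
          χ (a', (b, s), (c, s'), r) else 0 := by
  rw [breidbartSuperposition_apply, Finset.sum_eq_single ((bitsEquiv n).symm s)]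
  · by_cases h : s = s'
    · simp [recordedPart, h]
    · simp [recordedPart, h, Ne.symm h]
  · intro t _ ht
    rw [isRecorded_recordedPart χ t b s c s' r (Or.inl ?_), mul_zero]
    rintro rfl
    exact ht ((bitsEquiv n).symm_apply_apply t).symm
  · simp

variable [Fintype B] [DecidableEq B] [Fintype C] [DecidableEq C] [Fintype R] [DecidableEq R]

theorem aliceHom_ketbra_apply {A : Type*} [Fintype A] [DecidableEq A] (u : EuclideanSpace ℂ A)
    (x : EuclideanSpace ℂ (A × B × C × R)) (a : A) (p : B × C × R) :
    aliceHom A B C R (ketbra u) x (a, p) = u a * ∑ a', star (u a') * x (a', p) := by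
  change (Matrix.mulVec (ketbra u ⊗ₖ (1 : Matrix (B × C × R) (B × C × R) ℂ)) x.ofLp) (a, p) = _
  rw [Matrix.mulVec, dotProduct, Fintype.sum_prod_type, Finset.mul_sum]
  refine Finset.sum_congr rfl fun a' _ => ?_
  simp [Matrix.kroneckerMap_apply, Matrix.one_apply, ketbra, Matrix.vecMulVec_apply, mul_assoc]

theorem prod_ofFn_signProj_aliceObs (s : Fin (n * 2) → Fin 2) :
    (List.ofFn fun i => signProj (mixedObs (aliceObs n B C R i 0) (aliceObs n B C R i 1)
      (s (obsIndex i 0)) (s (obsIndex i 1))) 0).prod =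
      aliceHom (Fin n → Fin 2) B C R
        (ketbra (tensorPiVec fun i => wiesnerBreidbart ((bitsEquiv n).symm s i))) := by
  have h : ∀ i, signProj (mixedObs (aliceObs n B C R i 0) (aliceObs n B C R i 1)
      (s (obsIndex i 0)) (s (obsIndex i 1))) 0 = aliceHom (Fin n → Fin 2) B C R
        (factorHom i (ketbra (wiesnerBreidbart ((bitsEquiv n).symm s i)))) := fun i => by
    rw [← signProj_mixedObs_pauli, map_signProj, map_signProj, map_mixedObs, map_mixedObs,
      aliceObs, aliceObs, observable_alice_zero, observable_alice_one]
    rfl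
  simp only [h]
  rw [← tensorPiOp_ketbra, ← prod_ofFn_factorHom, map_list_prod, List.map_ofFn]
  rfl

/-- The outcome registers of both players, moved to the front. -/
def registersEquiv {A B C R S S' : Type*} :
    (S × S') × (A × B × C × R) ≃ A × (B × S) × (C × S') × R where
  toFun p := (p.2.1, (p.2.2.1, p.1.1), (p.2.2.2.1, p.1.2), p.2.2.2.2)
  invFun p := ((p.2.1.2, p.2.2.1.2), p.1, p.2.1.1, p.2.2.1.1, p.2.2.2)
  left_inv _ := rfl
  right_inv _ := rfl

theorem norm_ap_seqIsometry {A : Type*} [Fintype A] [DecidableEq A] {m : ℕ}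
    (T : Fin m → Matrix B B ℂ) (U : Fin m → Matrix C C ℂ)
    (x : EuclideanSpace ℂ (A × B × C × R)) :
    ‖ap ((1 : Matrix A A ℂ) ⊗ₖ (seqIsometry T ⊗ₖ (seqIsometry U ⊗ₖ (1 : Matrix R R ℂ)))) x‖ =
      l2norm (dilate (fun j => bobHom A B C R (T j)) (fun j => charlieHom A B C R (U j)) x) :=
  norm_eq_l2norm_of_equiv registersEquiv _ _ fun p q =>
    ap_seqIsometry_apply T U x q.1 q.2.1 p.1 q.2.2.1 p.2 q.2.2.2

/-- Identifies this projection with the product of spectral projectors in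
`l2norm_dilate_sub_project_le`. -/
theorem norm_sub_breidbartSuperposition_recordedPart (T : Fin (n * 2) → Matrix B B ℂ)
    (U : Fin (n * 2) → Matrix C C ℂ) (x : EuclideanSpace ℂ ((Fin n → Fin 2) × B × C × R)) :
    let χ := ap ((1 : Matrix (Fin n → Fin 2) (Fin n → Fin 2) ℂ) ⊗ₖ
      (seqIsometry T ⊗ₖ (seqIsometry U ⊗ₖ (1 : Matrix R R ℂ)))) x
    let D := dilate (fun j => bobHom (Fin n → Fin 2) B C R (T j))
      (fun j => charlieHom (Fin n → Fin 2) B C R (U j)) x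
    ‖χ - breidbartSuperposition (recordedPart χ)‖ =
      l2norm fun p => D p - if p.1 = p.2 then
        (List.ofFn fun i => signProj (mixedObs (aliceObs n B C R i 0) (aliceObs n B C R i 1)
          (p.1 (obsIndex i 0)) (p.1 (obsIndex i 1))) 0).prod (D p) else 0 := by
  intro χ D
  refine norm_eq_l2norm_of_equiv registersEquiv _ _ ?_
  rintro ⟨s, s'⟩ ⟨a, b, c, r⟩
  have hχ : ∀ a s', χ (a, (b, s), (c, s'), r) = D (s, s') (a, b, c, r) := fun a s' =>
    ap_seqIsometry_apply T U x a b s c s' r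
  simp only [PiLp.sub_apply, registersEquiv, Equiv.coe_fn_mk, breidbartSuperposition_recordedPart_apply, hχ,
    prod_ofFn_signProj_aliceObs]
  congr 1
  split_ifs with h
  · rw [aliceHom_ketbra_apply]
  · rfl

theorem tensorPiVec_breidbart_ne_zero :
    tensorPiVec (fun _ : Fin n => wiesnerBreidbart 0) 0 ≠ 0 := by
  have h : (wiesnerBreidbart 0).ofLp 0 ≠ 0 := by
    have hc : Real.cos (Real.pi / 8) ≠ 0 := by
      intro h0
      have := cos_sq_pi_div_eight
      rw [h0] at this
      have h2 := Real.sqrt_nonneg 2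
      linarith
    rw [wiesnerBreidbart, ap, ofLp_breidbart]
    simpa [-Real.cos_pi_div_eight, -Real.sin_pi_div_eight, -Complex.ofReal_cos] using hc
  change ∏ _i : Fin n, (wiesnerBreidbart 0).ofLp 0 ≠ 0
  exact Finset.prod_ne_zero_iff.mpr fun i _ => h

/-- A substitute for the projected state when the latter vanishes and cannot be normalized. -/
theorem exists_isRecorded_norm_eq_one (b : B) (c : C) (r : R) : ∃ ψ : (Fin n → Fin 2 → Fin 2) →
    EuclideanSpace ℂ ((B × (Fin (n * 2) → Fin 2)) × (C × (Fin (n * 2) → Fin 2)) × R),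
    IsRecorded ψ ∧ ‖breidbartSuperposition ψ‖ = 1 := by
  let ψ : (Fin n → Fin 2 → Fin 2) →
      EuclideanSpace ℂ ((B × (Fin (n * 2) → Fin 2)) × (C × (Fin (n * 2) → Fin 2)) × R) := fun t =>
    if t = 0 then EuclideanSpace.single ((b, bitsEquiv n 0), (c, bitsEquiv n 0), r) 1 else 0
  have hψ : IsRecorded ψ := fun t b' s c' s' r' h => by
    by_cases ht : t = 0
    · subst ht
      simp only [ψ, if_true, PiLp.single_apply, Prod.mk.injEq]
      rw [if_neg]
      tauto
    · simp [ψ, ht]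
  have h0 : breidbartSuperposition ψ ≠ 0 := by
    intro h
    have h1 : breidbartSuperposition ψ (0, (b, bitsEquiv n 0), (c, bitsEquiv n 0), r) = 0 := by
      rw [h]
      rfl
    rw [breidbartSuperposition_apply, Finset.sum_eq_single 0 (by intro t _ ht; simp [ψ, ht])
      (by simp)] at h1
    simp only [ψ, if_true, PiLp.single_apply, mul_one] at h1
    exact tensorPiVec_breidbart_ne_zero h1
  refine ⟨_, hψ.smul ((‖breidbartSuperposition ψ‖⁻¹ : ℝ) : ℂ), ?_⟩
  rw [breidbartSuperposition_smul, norm_smul, Complex.norm_real, norm_inv, norm_norm,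
    inv_mul_cancel₀ (norm_ne_zero_iff.mpr h0)]

/-- A superposition that is close to a unit vector can be normalized. -/
theorem exists_isRecorded_norm_sub_le
    {χ : EuclideanSpace ℂ ((Fin n → Fin 2) × (B × (Fin (n * 2) → Fin 2)) ×
      (C × (Fin (n * 2) → Fin 2)) × R)} (hχ : ‖χ‖ = 1) {d : ℝ}
    {ψ : (Fin n → Fin 2 → Fin 2) →
      EuclideanSpace ℂ ((B × (Fin (n * 2) → Fin 2)) × (C × (Fin (n * 2) → Fin 2)) × R)}
    (hψ : IsRecorded ψ) (h : ‖χ - breidbartSuperposition ψ‖ ≤ d) :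
    ∃ ψ' : (Fin n → Fin 2 → Fin 2) →
      EuclideanSpace ℂ ((B × (Fin (n * 2) → Fin 2)) × (C × (Fin (n * 2) → Fin 2)) × R),
      IsRecorded ψ' ∧ ‖breidbartSuperposition ψ'‖ = 1 ∧
        ‖χ - breidbartSuperposition ψ'‖ ≤ 2 * d := by
  -- If the projection is zero, then d ≥ 1, and any unit vector is within 2 ≤ 2d. The registers are
  -- nonempty because χ is a unit vector.
  by_cases h0 : breidbartSuperposition ψ = 0
  · rw [h0, sub_zero, hχ] at h
    have hne : Nonempty (((Fin n → Fin 2) × (B × (Fin (n * 2) → Fin 2)) ×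
        (C × (Fin (n * 2) → Fin 2)) × R)) := by
      by_contra hempty
      rw [not_nonempty_iff] at hempty
      rw [Subsingleton.elim χ 0, norm_zero] at hχ
      exact zero_ne_one hχ
    obtain ⟨_, ⟨b, _⟩, ⟨c, _⟩, r⟩ := hne
    obtain ⟨ψ', h1, h2⟩ := exists_isRecorded_norm_eq_one (n := n) b c r
    refine ⟨ψ', h1, h2, (norm_sub_le _ _).trans ?_⟩
    linarith
  · have hpos : 0 < ‖breidbartSuperposition ψ‖ := norm_pos_iff.mpr h0
    refine ⟨_, hψ.smul ((‖breidbartSuperposition ψ‖⁻¹ : ℝ) : ℂ), ?_, ?_⟩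
    · rw [breidbartSuperposition_smul, norm_smul, Complex.norm_real, norm_inv, norm_norm,
        inv_mul_cancel₀ hpos.ne']
    · rw [breidbartSuperposition_smul]
      set y := breidbartSuperposition ψ with hy
      have h1 : y - ((‖y‖⁻¹ : ℝ) : ℂ) • y = ((1 - ‖y‖⁻¹ : ℝ) : ℂ) • y := by
        push_cast
        module
      -- Normalizing moves y by the difference of its norm from 1 = ‖χ‖, which is again at most d.
      have h2 : ‖y - ((‖y‖⁻¹ : ℝ) : ℂ) • y‖ = |‖y‖ - 1| := by
        rw [h1, norm_smul, Complex.norm_real, Real.norm_eq_abs]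
        nth_rw 2 [← abs_of_pos hpos]
        rw [← abs_mul, sub_mul, inv_mul_cancel₀ hpos.ne', one_mul]
      have h3 : |‖y‖ - 1| ≤ d := by
        rw [← hχ, abs_sub_comm]
        exact (abs_norm_sub_norm_le _ _).trans h
      have h4 := norm_sub_le_norm_sub_add_norm_sub χ y (((‖y‖⁻¹ : ℝ) : ℂ) • y)
      linarith

end Projection

end

/-! ### The rigidity theorem -/

theorem mainTheorem1 :
    ∃ K L : ℝ, 0 ≤ K ∧ 0 ≤ L ∧
      ∀ (n : ℕ), 1 ≤ n →
      ∀ (B : Type u) (C : Type v) (R : Type w) [Fintype B] [DecidableEq B] [Fintype C]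
        [DecidableEq C] [Fintype R] [DecidableEq R]
        (S : PurifiedStrategy (TFKW.parallel n) B C R) (ε : ℝ), 0 ≤ ε →
        (∀ i : Fin n, Real.cos (Real.pi / 8) ^ 2 - ε ≤ S.roundWinProb i) →
        ∃ (B' : Type u) (C' : Type v) (_ : Fintype B') (_ : DecidableEq B') (_ : Fintype C')
          (_ : DecidableEq C') (V : Matrix B' B ℂ) (W : Matrix C' C ℂ)
          (ψ : (Fin n → Fin 2 → Fin 2) → EuclideanSpace ℂ (B' × C' × R))
          (φ : Fin n → Fin n → Fin 2)
          (Bobs : Fin n → Fin 2 → Matrix B' B' ℂ) (Cobs : Fin n → Fin 2 → Matrix C' C' ℂ),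
          IsIsometryOp V ∧ IsIsometryOp W ∧
          -- the superposition is a quantum state close to the dilated shared state
          ‖breidbartSuperposition ψ‖ = 1 ∧
          ‖ap ((1 : Matrix (Fin n → Fin 2) (Fin n → Fin 2) ℂ) ⊗ₖ
              (V ⊗ₖ (W ⊗ₖ (1 : Matrix R R ℂ)))) S.state - breidbartSuperposition ψ‖
            ≤ K * (n : ℝ) ^ 3 * Real.sqrt ε ∧
          -- orthogonal supports on both sides
          (∀ t t', t ≠ t' → supportBob (ψ t) ⟂ supportBob (ψ t')) ∧
          (∀ t t', t ≠ t' → supportCharlie (ψ t) ⟂ supportCharlie (ψ t')) ∧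
          -- commuting unitary observables on each side
          (∀ i θ, IsUnitaryObservable (Bobs i θ)) ∧
          (∀ i θ, IsUnitaryObservable (Cobs i θ)) ∧
          (∀ i θ i' θ', Commute (Bobs i θ) (Bobs i' θ')) ∧
          (∀ i θ i' θ', Commute (Cobs i θ) (Cobs i' θ')) ∧
          -- for each round `i`, the string `φ i` fixes the questions of the other rounds
          (∀ i, φ i i = 0) ∧
          (∀ i θ,
            ‖ap (onBob (Fin n → Fin 2) C R (V * S.bobObs (φ i) i θ)) S.state -
              ap (onBob (Fin n → Fin 2) C R (Bobs i θ * V)) S.state‖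
              ≤ L * (n : ℝ) ^ 2 * Real.sqrt ε) ∧
          (∀ i θ,
            ‖ap (onCharlie (Fin n → Fin 2) B R (W * S.charlieObs (φ i) i θ)) S.state -
              ap (onCharlie (Fin n → Fin 2) B R (Cobs i θ * W)) S.state‖
              ≤ L * (n : ℝ) ^ 2 * Real.sqrt ε) ∧
          (∀ i θ t,
            ap (Bobs i θ ⊗ₖ ((1 : Matrix C' C' ℂ) ⊗ₖ (1 : Matrix R R ℂ))) (ψ t) =
              (-1 : ℂ) ^ (t i θ : ℕ) • ψ t) ∧
          (∀ i θ t,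
            ap ((1 : Matrix B' B' ℂ) ⊗ₖ (Cobs i θ ⊗ₖ (1 : Matrix R R ℂ))) (ψ t) =
              (-1 : ℂ) ^ (t i θ : ℕ) • ψ t) := by 
  -- 414 = 2 · 207, doubled by the normalization; 66 = 2(25 + 2 · 4).
  refine ⟨414, 66, by norm_num, by norm_num, ?_⟩
  intro n hn B C R _ _ _ _ _ _ S ε hε hwin
  choose φ hφ hval using fun i => S.exists_le_roundValue i (hwin i)
  have hround := fun i => S.isRound (hφ i) (hval i)
  set bM : Fin n → Fin 2 → Matrix B B ℂ := fun i θ => S.bobObs (φ i) i θ with hbM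
  set cM : Fin n → Fin 2 → Matrix C C ℂ := fun i θ => S.charlieObs (φ i) i θ with hcM
  set a := aliceObs n B C R with ha
  set b := fun i θ => bobHom (Fin n → Fin 2) B C R (bM i θ) with hb
  set c := fun i θ => charlieHom (Fin n → Fin 2) B C R (cM i θ) with hc
  have hr : ∀ i, IsRound (a i 0) (a i 1) (b i 0) (b i 1) (c i 0) (c i 1) S.state ε := hround
  have hab : ∀ i θ j θ', Commute (a i θ) (b j θ') := fun _ _ _ _ =>
    commute_aliceHom_bobHom _ _ _ _ _ _
  have hac : ∀ i θ j θ', Commute (a i θ) (c j θ') := fun _ _ _ _ =>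
    commute_aliceHom_charlieHom _ _ _ _ _ _
  have hbc : ∀ i θ j θ', Commute (b i θ) (c j θ') := fun _ _ _ _ =>
    commute_bobHom_charlieHom _ _ _ _ _ _
  have hn' : (1 : ℝ) ≤ n := by exact_mod_cast hn
  have hn2 : 66 * (n : ℝ) * √ε ≤ 66 * (n : ℝ) ^ 2 * √ε := by
    gcongr
    exact le_self_pow₀ hn' (by norm_num)
  -- The estimate obtained is quadratic in n; the cubic one follows since n ≥ 1.
  have hn3 : 2 * (207 * (n : ℝ) ^ 2 * √ε) ≤ 414 * (n : ℝ) ^ 3 * √ε := by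
    have : (n : ℝ) ^ 2 * √ε ≤ (n : ℝ) ^ 3 * √ε := by
      gcongr
      norm_num
    linarith
  have hdist := l2norm_dilate_sub_project_le hn hr hab hac hbc
  have hnorm := norm_ap_seqIsometry (obsSeq bM) (obsSeq cM) S.state
  have hproj := norm_sub_breidbartSuperposition_recordedPart (obsSeq bM) (obsSeq cM) S.state
  have hχ := hnorm.trans ((l2norm_dilate (b := obsSeq b) (c := obsSeq c)
    (fun _ => isReflection_bob_rounds hr _ _)
    (fun _ => isReflection_bob_rounds (fun i => (hr i).swap_players) _ _) S.state).trans
      S.norm_state)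
  obtain ⟨ψ, hψ, hψ1, hψ2⟩ := exists_isRecorded_norm_sub_le hχ
    (isRecorded_recordedPart _) (hproj.le.trans hdist)
  refine ⟨B × (Fin (n * 2) → Fin 2), C × (Fin (n * 2) → Fin 2), inferInstance, inferInstance,
    inferInstance, inferInstance, seqIsometry (obsSeq bM), seqIsometry (obsSeq cM), ψ, φ,
    fun i θ => signObs B (obsIndex i θ), fun i θ => signObs C (obsIndex i θ),
    isIsometryOp_seqIsometry (fun _ => POVM.isHermitian_observable _)
      (fun _ => (S.bob_projective _).observable_mul_self _),
    isIsometryOp_seqIsometry (fun _ => POVM.isHermitian_observable _)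
      (fun _ => (S.charlie_projective _).observable_mul_self _),
    hψ1, hψ2.trans hn3, fun _ _ => hψ.isOrtho_supportBob, fun _ _ => hψ.isOrtho_supportCharlie,
    fun _ _ => isUnitaryObservable_signObs _, fun _ _ => isUnitaryObservable_signObs _,
    fun _ _ _ _ => commute_signObs _ _, fun _ _ _ _ => commute_signObs _ _, hφ, ?_, ?_,
    hψ.ap_signObs_bob, hψ.ap_signObs_charlie⟩
  · intro i θ
    have h := l2norm_obsSeq_le hr hab hac hbc (obsIndex i θ)
    rw [obsSeq_obsIndex] at h
    rw [norm_onBob_seqIsometry_sub]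
    exact h.trans hn2
  · intro i θ
    have h := l2norm_obsSeq_le (fun i => (hr i).swap_players) hac hab
      (fun i θ j θ' => (hbc j θ' i θ).symm) (obsIndex i θ)
    rw [obsSeq_obsIndex] at h
    rw [norm_onCharlie_seqIsometry_sub]
    exact h.trans hn2
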